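/- Let $m,n\ge 0$ and $p\ge 1$ be integers, let $M\in\mathbb R$, $\beta>0$, $h_0>0$, and write, for such $M,\beta$, $$W_{M,\beta}=\{x\in\mathbb C:\ \operatorname{Re}x\ge M,\ |\operatorname{Im}x|\le\beta(\operatorname{Re}x-M)\}.$$ For $0<h\le h_0$ let $A_{11}(x,h)\in\mathbb C^{m\times m}$, $A_{22}(x,h)\in\mathbb C^{n\times n}$ and $\Theta(x,h)\in\mathbb C^{(m+n)\times(m+n)}$ be analytic in $x$ on (a neighborhood of) $W_{M,\beta}$, and suppose that there are matrices $A_{jj}(+\infty,h)$, $0\le h\le h_0$, and constants $C,\eta>0$ such that $$|A_{jj}(x,h)-A_{jj}(+\infty,h)|\le Ce^{-\eta\operatorname{Re}x},\qquad |\Theta(x,h)|\le C\qquad (x\in W_{M,\beta},\ 0<h\le h_0,\ j=1,2).$$ Suppose further that $A_{jj}(+\infty,h)\to A_{jj}(+\infty,0)$ as $h\to0^+$, and that $A_{11}(+\infty,0)$ and $A_{22}(+\infty,0)$ have no eigenvalue in common. Then there are $M'\ge M$, $0<\beta'\le\beta$, $0<h_1\le h_0$ and matrices $T(x,h)\in\mathbb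 C^{(m+n)\times(m+n)}$, for $x$ in a neighborhood of $W_{M',\beta'}$ (possibly depending on $h$) and $0<h\le h_1$, such that: 1. For each $h$, $T(\cdot,h)$ is analytic on (a neighborhood of) $W_{M',\beta'}$ with invertible values on $W_{M',\beta'}$, and $W=TZ$ transforms the system $$hW'=\begin{pmatrix}A_{11}&0\\0&A_{22}\end{pmatrix}W+h^p\,\Theta W$$ on $W_{M',\beta'}$ into a block-diagonal system $hZ'=\begin{pmatrix}D_1&0\\0&D_2\end{pmatrix}Z$ with $D_1(\cdot,h)\in\mathbb C^{m\times m}$ and $D_2(\cdot,h)\in\mathbb C^{n\times n}$ analytic; that is, $hT'+T\,\mathrm{diag}(D_1,D_2)=(\mathrm{diag}(A_{11},A_{22})+h^p\Theta)T$ there. 2. $T$ is bounded on $W_{M',\beta'}$ uniformly in $0<h\le h_1$, and $|T-\mathrm{Id}|\le C'h^p$ on $W_{M',\beta'}$ for $0<h\le h_1$, with $C'$ independent of $x$ and $h$. 3. If $\Theta$ is uniformly exponentially convergent, i.e. $|\Theta(x,h)-\Theta(+\infty,h)|\le C_1e^{-\eta_1\operatorname{Re}x}$ on $W_{M,\beta}$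 for all $0<h\le h_0$, for some matrices $\Theta(+\infty,h)$ and constants $C_1$ and $\eta_1>0$, then so is $T$: $|T(x,h)-T(+\infty,h)|\le C_2e^{-\eta_2\operatorname{Re}x}$ on $W_{M',\beta'}$ for all $0<h\le h_1$, for some matrices $T(+\infty,h)$ and constants $C_2$ and $\eta_2>0$. 4. If $|\Theta(x,h)|\le C_1e^{-\eta_1\operatorname{Re}x}$ on $W_{M,\beta}$ for all $0<h\le h_0$, for some constants $C_1$ and $\eta_1>0$, then $|T(x,h)-\mathrm{Id}|\le C_2e^{-\eta_2\operatorname{Re}x}$ on $W_{M',\beta'}$ for all $0<h\le h_1$, for some constants $C_2$ and $\eta_2>0$. -/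

import Mathlib

open Set Filter Topology

-- Matrices carry the operator norm induced by the sup norm on vectors; since dimensions are fixed,
-- the choice of matrix norm is immaterial for the bounds below.
attribute [local instance] Matrix.linftyOpNormedAddCommGroup Matrix.linftyOpNormedSpace
attribute [local instance] Matrix.linftyOpNormedRing Matrix.linftyOpNormedAlgebra

namespace BlockDiag

/-- The closed wedge around `+∞` with vertex `M` on the real axis and slope `β`:
`Re x ≥ M` and `|Im x| ≤ β (Re x - M)`. -/
def wedge (M β : ℝ) : Set ℂ := {x | M ≤ x.re ∧ |x.im| ≤ β * (x.re - M)}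

/-- `F h x` converges exponentially to `L h` as `Re x → ∞` in `S`, uniformly for `0 < h ≤ h₀`. -/
def UniformExpConv {E : Type*} [NormedAddCommGroup E] (h₀ : ℝ) (S : Set ℂ)
    (F : ℝ → ℂ → E) (L : ℝ → E) : Prop :=
  ∃ C η : ℝ, 0 < η ∧ ∀ h ∈ Ioc 0 h₀, ∀ x ∈ S, ‖F h x - L h‖ ≤ C * Real.exp (-η * x.re)

/-- `F h x` is bounded for `x ∈ S`, uniformly for `0 < h ≤ h₀`. -/
def UniformBdd {E : Type*} [NormedAddCommGroup E] (h₀ : ℝ) (S : Set ℂ)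
    (F : ℝ → ℂ → E) : Prop :=
  ∃ C : ℝ, ∀ h ∈ Ioc 0 h₀, ∀ x ∈ S, ‖F h x‖ ≤ C

/-- The coefficient `diag(A₁₁, A₂₂) + h ^ p Θ` of the system
`h W' = diag(A₁₁, A₂₂) W + h ^ p Θ W`. -/
def coeff {m n : ℕ} (p : ℕ)
    (A₁₁ : ℝ → ℂ → Matrix (Fin m) (Fin m) ℂ) (A₂₂ : ℝ → ℂ → Matrix (Fin n) (Fin n) ℂ)
    (Θ : ℝ → ℂ → Matrix (Fin m ⊕ Fin n) (Fin m ⊕ Fin n) ℂ) (h : ℝ) (x : ℂ) :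
    Matrix (Fin m ⊕ Fin n) (Fin m ⊕ Fin n) ℂ :=
  Matrix.fromBlocks (A₁₁ h x) 0 0 (A₂₂ h x) + ((h : ℂ) ^ p) • Θ h x

/-- `T` is an analytic block-diagonalizing conjugator on `S` of `h W' = G(x) W`: it is analytic with
invertible values, and the change of coordinates `W = T Z` transforms the system into
`h Z' = diag(D₁, D₂) Z` with `D₁`, `D₂` analytic. Substituting `W = T Z` and cancelling `Z`,
the latter means `h T' + T diag(D₁, D₂) = G T`. -/
def IsBlockDiagConjugator {m n : ℕ} (h : ℝ) (S : Set ℂ)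
    (G T : ℂ → Matrix (Fin m ⊕ Fin n) (Fin m ⊕ Fin n) ℂ) : Prop :=
  AnalyticOnNhd ℂ T S ∧ (∀ x ∈ S, IsUnit (T x)) ∧
    ∃ (D₁ : ℂ → Matrix (Fin m) (Fin m) ℂ) (D₂ : ℂ → Matrix (Fin n) (Fin n) ℂ),
      AnalyticOnNhd ℂ D₁ S ∧ AnalyticOnNhd ℂ D₂ S ∧
        ∀ x ∈ S, (h : ℂ) • deriv T x + T x * Matrix.fromBlocks (D₁ x) 0 0 (D₂ x) = G x * T x

end BlockDiag

/-!
A conjugator `T = [[1, X], [Y, 1]]` block-diagonalizes `h W' = G W` exactly when the graphs of `Y`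
and `X` are invariant, i.e. when `Y` and `X` solve matrix Riccati equations whose forcing terms are
the off-diagonal blocks of `G`, of size `h ^ p`. The linear part of such an equation is
`h y' = Λ y`, where `Λ` is a Sylvester operator that is invertible because the diagonal blocks of
the limit have no common eigenvalue. The substitution `x = M + h z` removes `h`, and for an
eigenvalue `l ≠ 0` of `Λ` the equation `u' = l u + f` is solved boundedly on a thin cone by Duhamel
integrals: along rays to infinity if `e ^ (-l z)` decays along some ray, and along the segment to
the vertex otherwise. A contraction then gives the solutions of the Riccati equations, on a wedge
far enough to the right and for small `h`. For the exponential convergence, write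
`y = a + e ^ (-η x) v` with `a` an equilibrium of the limiting equation: `v` is a bounded solution
of another Riccati equation with nearly the same linear part.
-/

namespace BlockDiag

open MeasureTheory
open scoped BoundedContinuousFunction

section BoundedHolomorphic

variable {U V : Set ℂ} {E F : Type*} [NormedAddCommGroup E] [NormedAddCommGroup F]

/-- The extension by `0` to `ℂ` of a function on a subset. -/
noncomputable def zeroExt (g : U → E) : ℂ → E := Function.extend (↑) g 0

theorem zeroExt_coe (g : U → E) (x : U) : zeroExt g x = g x :=
  Subtype.val_injective.extend_apply ..

variable [NormedSpace ℂ E] [NormedSpace ℂ F]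

theorem differentiableOn_zeroExt_iff {g : U → E} {f : ℂ → E} (hfg : ∀ x : U, g x = f x) :
    DifferentiableOn ℂ (zeroExt g) U ↔ DifferentiableOn ℂ f U :=
  differentiableOn_congr fun x hx => by
    lift x to U using hx
    rw [zeroExt_coe, hfg]

/-- The bounded continuous functions on `U` that are holomorphic; holomorphy is expressed through
the extension by `0` to `ℂ`. -/
def bddHol (U : Set ℂ) (E : Type*) [NormedAddCommGroup E] [NormedSpace ℂ E] :
    Submodule ℂ (U →ᵇ E) where
  carrier := {u : U →ᵇ E | DifferentiableOn ℂ (zeroExt u) U}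
  zero_mem' := (differentiableOn_zeroExt_iff fun _ => rfl).2 (differentiableOn_const 0)
  add_mem' hu hv := (differentiableOn_zeroExt_iff fun _ => by simp [zeroExt_coe]).2
    (DifferentiableOn.add hu hv)
  smul_mem' c _ hu := (differentiableOn_zeroExt_iff fun _ => by simp [zeroExt_coe]).2
    (DifferentiableOn.const_smul hu c)

/-- The space of bounded holomorphic functions `U → E`, with the supremum norm. -/
abbrev BddHol (U : Set ℂ) (E : Type*) [NormedAddCommGroup E] [NormedSpace ℂ E] : Type _ :=
  bddHol U E

namespace BddHol

/-- The value at `x` of a bounded holomorphic function on `U`, with junk value `0` off `U`. -/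
noncomputable def eval (u : BddHol U E) : ℂ → E := zeroExt u.1

noncomputable instance : CoeFun (BddHol U E) fun _ => ℂ → E := ⟨eval⟩

theorem differentiableOn (u : BddHol U E) : DifferentiableOn ℂ u U := u.2

theorem eval_coe (u : BddHol U E) (x : U) : u x = u.1 x :=
  zeroExt_coe u.1 x

theorem add_apply (u v : BddHol U E) {x : ℂ} (hx : x ∈ U) : (u + v) x = u x + v x := by
  lift x to U using hx
  simp [eval_coe]

theorem sub_apply (u v : BddHol U E) {x : ℂ} (hx : x ∈ U) : (u - v) x = u x - v x := by
  lift x to U using hx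
  simp [eval_coe]

theorem smul_apply (c : ℂ) (u : BddHol U E) {x : ℂ} (hx : x ∈ U) : (c • u) x = c • u x := by
  lift x to U using hx
  simp [eval_coe]

theorem zero_apply {x : ℂ} (hx : x ∈ U) : (0 : BddHol U E) x = 0 := by
  simpa only [zero_smul] using smul_apply 0 (0 : BddHol U E) hx

theorem norm_apply_le (u : BddHol U E) {x : ℂ} (hx : x ∈ U) : ‖u x‖ ≤ ‖u‖ := by
  lift x to U using hx
  exact (congrArg norm (eval_coe u x)).trans_le (u.1.norm_coe_le_norm x)

theorem norm_le {u : BddHol U E} {B : ℝ} (hB : 0 ≤ B) (h : ∀ x ∈ U, ‖u x‖ ≤ B) : ‖u‖ ≤ B :=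
  (BoundedContinuousFunction.norm_le hB).2 fun x =>
    (congrArg norm (eval_coe u x)).symm.trans_le (h x x.2)

theorem ext {u v : BddHol U E} (h : ∀ x ∈ U, u x = v x) : u = v := by
  ext x
  simpa only [eval_coe] using h x x.2

/-- The element of `BddHol U E` given by a function that is holomorphic and bounded on `U`. -/
noncomputable def of (f : ℂ → E) (hf : DifferentiableOn ℂ f U) (hB : ∃ B, ∀ x ∈ U, ‖f x‖ ≤ B) :
    BddHol U E :=
  ⟨.ofNormedAddCommGroup (fun x : U => f x) hf.continuousOn.domRestrict hB.choose
    fun x => hB.choose_spec x x.2, (differentiableOn_zeroExt_iff fun _ => rfl).2 hf⟩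

theorem of_apply {f : ℂ → E} {hf : DifferentiableOn ℂ f U} {hB : ∃ B, ∀ x ∈ U, ‖f x‖ ≤ B} {x : ℂ}
    (hx : x ∈ U) : of f hf hB x = f x :=
  eval_coe (of f hf hB) ⟨x, hx⟩

/-- The bounded linear operator given by a family of holomorphic functions that depends linearly on
an element of `BddHol U E`. -/
noncomputable def mkCLM (Φ : BddHol U E → ℂ → F) (C : ℝ)
    (hol : ∀ u, DifferentiableOn ℂ (Φ u) V)
    (hadd : ∀ u v, ∀ x ∈ V, Φ (u + v) x = Φ u x + Φ v x)
    (hsmul : ∀ (c : ℂ) (u), ∀ x ∈ V, Φ (c • u) x = c • Φ u x)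
    (bdd : ∀ u, ∀ x ∈ V, ‖Φ u x‖ ≤ C * ‖u‖) : BddHol U E →L[ℂ] BddHol V F :=
  LinearMap.mkContinuous
    { toFun := fun u => of (Φ u) (hol u) ⟨_, bdd u⟩
      map_add' := fun u v => ext fun x hx => by
        rw [add_apply _ _ hx, of_apply hx, of_apply hx, of_apply hx, hadd u v x hx]
      map_smul' := fun c u => ext fun x hx => by
        rw [RingHom.id_apply, smul_apply _ _ hx, of_apply hx, of_apply hx, hsmul c u x hx] }
    (max C 0) fun u => norm_le (by positivity) fun x hx => by
      refine (congrArg norm (of_apply (hf := hol u) hx)).trans_le ((bdd u x hx).trans ?_)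
      gcongr
      exact le_max_left _ _

section mkCLM

variable {Φ : BddHol U E → ℂ → F} {C : ℝ} {hol : ∀ u, DifferentiableOn ℂ (Φ u) V}
  {hadd : ∀ u v, ∀ x ∈ V, Φ (u + v) x = Φ u x + Φ v x}
  {hsmul : ∀ (c : ℂ) (u), ∀ x ∈ V, Φ (c • u) x = c • Φ u x}
  {bdd : ∀ u, ∀ x ∈ V, ‖Φ u x‖ ≤ C * ‖u‖}

theorem mkCLM_apply (u : BddHol U E) {x : ℂ} (hx : x ∈ V) :
    mkCLM Φ C hol hadd hsmul bdd u x = Φ u x :=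
  of_apply (hf := hol u) hx

theorem norm_mkCLM_le (hC : 0 ≤ C) : ‖mkCLM Φ C hol hadd hsmul bdd‖ ≤ C :=
  (LinearMap.mkContinuous_norm_le' _ _).trans_eq (by simpa using hC)

end mkCLM

/-- Postcomposition of bounded holomorphic functions with a bounded linear map. -/
noncomputable def postcomp (P : E →L[ℂ] F) : BddHol U E →L[ℂ] BddHol U F :=
  mkCLM (fun u x => P (u x)) ‖P‖
    (fun u => P.differentiable.comp_differentiableOn u.differentiableOn)
    (fun u v x hx => by rw [add_apply u v hx, map_add])
    (fun c u x hx => by rw [smul_apply c u hx, map_smul])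
    (fun u x hx => (P.le_opNorm _).trans (by gcongr; exact u.norm_apply_le hx))

theorem postcomp_apply (P : E →L[ℂ] F) (u : BddHol U E) {x : ℂ} (hx : x ∈ U) :
    postcomp P u x = P (u x) :=
  mkCLM_apply u hx

/-- Precomposition of bounded holomorphic functions with a holomorphic map. -/
noncomputable def precomp (φ : ℂ → ℂ) (hφ : Differentiable ℂ φ) (hm : MapsTo φ V U) :
    BddHol U E →L[ℂ] BddHol V E :=
  mkCLM (fun u x => u (φ x)) 1 (fun u => u.differentiableOn.comp hφ.differentiableOn hm)
    (fun u v _ hx => add_apply u v (hm hx)) (fun c u _ hx => smul_apply c u (hm hx))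
    (fun u _ hx => (u.norm_apply_le (hm hx)).trans_eq (one_mul _).symm)

theorem precomp_apply {φ : ℂ → ℂ} (hφ : Differentiable ℂ φ) (hm : MapsTo φ V U) (u : BddHol U E)
    {x : ℂ} (hx : x ∈ V) : precomp φ hφ hm u x = u (φ x) :=
  mkCLM_apply u hx

theorem norm_precomp_le {φ : ℂ → ℂ} (hφ : Differentiable ℂ φ) (hm : MapsTo φ V U) :
    ‖(precomp φ hφ hm : BddHol U E →L[ℂ] BddHol V E)‖ ≤ 1 :=
  norm_mkCLM_le zero_le_one

theorem completeSpace [CompleteSpace E] (hU : IsOpen U) : CompleteSpace (BddHol U E) := by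
  refine IsClosed.completeSpace_coe (hs := IsSeqClosed.isClosed fun u v hu hv => ?_)
  have huv : TendstoUniformlyOn (fun n => zeroExt (u n)) (zeroExt v) atTop U := by
    rw [Metric.tendstoUniformlyOn_iff]
    intro ε hε
    filter_upwards [Metric.tendstoUniformly_iff.1
      (BoundedContinuousFunction.tendsto_iff_tendstoUniformly.1 hv) ε hε] with n hn x hx
    lift x to U using hx
    simpa only [zeroExt_coe] using hn x
  exact huv.tendstoLocallyUniformlyOn.differentiableOn (.of_forall fun n => hu n) hU

end BddHol

end BoundedHolomorphic

section Duhamel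

variable {U : Set ℂ} {l : ℂ} {E : Type*} [NormedAddCommGroup E] [NormedSpace ℂ E]

theorem hasDerivAt_integral_of_differentiableOn {α : Type*} [MeasurableSpace α] {μ : Measure α}
    {V : Set ℂ} {z₀ : ℂ} (hV : V ∈ 𝓝 z₀) {ψ : ℂ → α → E} {bound : α → ℝ}
    (hbound_int : Integrable bound μ)
    (hmeas : ∀ z ∈ V, AEStronglyMeasurable (ψ z) μ)
    (hmeas' : AEStronglyMeasurable (fun t => deriv (ψ · t) z₀) μ)
    (hdiff : ∀ᵐ t ∂μ, DifferentiableOn ℂ (ψ · t) V)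
    (hbound : ∀ᵐ t ∂μ, ∀ z ∈ V, ‖ψ z t‖ ≤ bound t) :
    Integrable (fun t => deriv (ψ · t) z₀) μ ∧
      HasDerivAt (fun z => ∫ t, ψ z t ∂μ) (∫ t, deriv (ψ · t) z₀ ∂μ) z₀ := by
  obtain ⟨r, hr, hrV⟩ := Metric.mem_nhds_iff.1 hV
  have hsub : ∀ z ∈ Metric.ball z₀ (r / 2), Metric.closedBall z (r / 2) ⊆ Metric.ball z₀ r :=
    fun z hz w hw => by
      rw [Metric.mem_ball] at *
      rw [Metric.mem_closedBall] at hw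
      linarith [dist_triangle w z z₀]
  refine hasDerivAt_integral_of_dominated_loc_of_deriv_le (s := Metric.ball z₀ (r / 2))
    (F' := fun z t => deriv (ψ · t) z) (bound := fun t => bound t / (r / 2))
    (Metric.ball_mem_nhds _ (by positivity)) ?_ ?_ hmeas' ?_ (hbound_int.div_const _) ?_
  · filter_upwards [hV] with z hz using hmeas z hz
  · exact hbound_int.mono' (hmeas _ (mem_of_mem_nhds hV))
      (hbound.mono fun t ht => ht _ (mem_of_mem_nhds hV))
  · filter_upwards [hdiff, hbound] with t ht htb z hz
    have hz' := (hsub z hz).trans hrV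
    exact Complex.norm_deriv_le_of_forall_mem_sphere_norm_le (by positivity)
      ((ht.mono (Metric.closure_ball_subset_closedBall.trans hz')).diffContOnCl)
      fun w hw => htb w (hz' (Metric.sphere_subset_closedBall hw))
  · filter_upwards [hdiff] with t ht z hz
    have hzV : V ∈ 𝓝 z := mem_of_superset (Metric.isOpen_ball.mem_nhds
      (hsub z hz (Metric.mem_closedBall_self (by positivity)))) hrV
    exact (ht.differentiableAt hzV).hasDerivAt

/-- A family of paths `t ↦ a t * z + c t` in `U`, starting at `z` and depending affinely on `z`,
along which Duhamel's formula gives a solution of `u' = l u + f` that is bounded if `f` is: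
`exp (l (z - ·))` decays along the path from `z`, at least as fast as the path moves. -/
structure DuhamelPath (U : Set ℂ) (l : ℂ) where
  a : ℝ → ℂ
  c : ℝ → ℂ
  a' : ℝ → ℂ
  c' : ℝ → ℂ
  rate : ℝ
  continuous_a' : Continuous a'
  continuous_c' : Continuous c'
  hasDerivAt_a : ∀ t, HasDerivAt a (a' t) t
  hasDerivAt_c : ∀ t, HasDerivAt c (c' t) t
  a_zero : a 0 = 1
  c_zero : c 0 = 0
  mem : ∀ z ∈ U, ∀ t, 0 ≤ t → a t * z + c t ∈ U
  rate_pos : 0 < rate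
  rate_le : ∀ z ∈ U, ∀ t, rate * ‖a' t * z + c' t‖ ≤ (l * (a' t * z + c' t)).re
  tendsto_exp : ∀ z ∈ U, ∃ m,
    Tendsto (fun t => Real.exp (l * (z - (a t * z + c t))).re) atTop (𝓝 m)
  tendsto_mul_exp : ∀ z ∈ U,
    Tendsto (fun t => ‖a t‖ * Real.exp (l * (z - (a t * z + c t))).re) atTop (𝓝 0)
  dominated : ∀ z₀ ∈ U, ∃ g : ℝ → ℝ, IntegrableOn g (Ioi 0) ∧ ∀ᶠ z in 𝓝 z₀, ∀ t ∈ Ioi (0 : ℝ),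
    ‖a' t * z + c' t‖ * Real.exp (l * (z - (a t * z + c t))).re ≤ g t

namespace DuhamelPath

variable (γ : DuhamelPath U l) (f : BddHol U E) {z : ℂ} {t : ℝ}

/-- The point reached at time `t` from `z`. -/
noncomputable def path (z : ℂ) (t : ℝ) : ℂ := γ.a t * z + γ.c t

/-- The time derivative of `path`. -/
noncomputable def velocity (z : ℂ) (t : ℝ) : ℂ := γ.a' t * z + γ.c' t

/-- The propagator of `u' = l u` along the path, from the point at time `t` back to `z`. -/
noncomputable def propagator (z : ℂ) (t : ℝ) : ℂ := Complex.exp (l * (z - γ.path z t))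

theorem path_zero (z : ℂ) : γ.path z 0 = z := by
  simp [path, γ.a_zero, γ.c_zero]

theorem norm_propagator (z : ℂ) (t : ℝ) :
    ‖γ.propagator z t‖ = Real.exp (l * (z - γ.path z t)).re :=
  Complex.norm_exp _

theorem hasDerivAt_path (z : ℂ) (t : ℝ) : HasDerivAt (γ.path z) (γ.velocity z t) t :=
  ((γ.hasDerivAt_a t).mul_const z).add (γ.hasDerivAt_c t)

theorem hasDerivAt_propagator (z : ℂ) (t : ℝ) :
    HasDerivAt (γ.propagator z) (-(l * γ.velocity z t) * γ.propagator z t) t :=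
  (((γ.hasDerivAt_path z t).const_sub z).const_mul l).cexp.congr_deriv
    (by rw [propagator]; ring)

theorem hasDerivAt_norm_propagator (z : ℂ) (t : ℝ) :
    HasDerivAt (fun t => -‖γ.propagator z t‖)
      ((l * γ.velocity z t).re * ‖γ.propagator z t‖) t := by
  have hre := Complex.reCLM.hasFDerivAt.comp_hasDerivAt t
    (((γ.hasDerivAt_path z t).const_sub z).const_mul l)
  simp only [norm_propagator]
  exact hre.exp.neg.congr_deriv (by
    simp only [mul_neg, map_neg, Complex.reCLM_apply, Function.comp_apply]
    ring)

/-- The integrand of Duhamel's formula. -/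
noncomputable def integrand (z : ℂ) (t : ℝ) : E :=
  -(γ.propagator z t * γ.velocity z t) • f (γ.path z t)

/-- Duhamel's formula for a solution of `u' = l u + f`, as an integral from the far end of the path
back to `z`. -/
noncomputable def solution (z : ℂ) : E := ∫ t in Ioi (0 : ℝ), γ.integrand f z t

/-- The function whose time derivative measures the failure of the integrand of Duhamel's formula
to solve `u' = l u`. -/
noncomputable def flux (z : ℂ) (t : ℝ) : E := (γ.propagator z t * γ.a t) • f (γ.path z t)

theorem norm_integrand_le (hz : z ∈ U) (ht : 0 ≤ t) :
    ‖γ.integrand f z t‖ ≤ ‖γ.velocity z t‖ * ‖γ.propagator z t‖ * ‖f‖ := by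
  rw [integrand, norm_smul, norm_neg, norm_mul, mul_comm ‖γ.propagator z t‖]
  gcongr
  exact f.norm_apply_le (γ.mem z hz t ht)

theorem norm_integrand_le_rate (hz : z ∈ U) (ht : 0 ≤ t) :
    ‖γ.integrand f z t‖ ≤ (l * γ.velocity z t).re * ‖γ.propagator z t‖ * (γ.rate⁻¹ * ‖f‖) := by
  have hv : ‖γ.velocity z t‖ ≤ (l * γ.velocity z t).re * γ.rate⁻¹ := by
    rw [← div_eq_mul_inv, le_div_iff₀' γ.rate_pos]
    exact γ.rate_le z hz t
  calc ‖γ.integrand f z t‖ ≤ ‖γ.velocity z t‖ * ‖γ.propagator z t‖ * ‖f‖ :=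
        γ.norm_integrand_le f hz ht
    _ ≤ (l * γ.velocity z t).re * γ.rate⁻¹ * ‖γ.propagator z t‖ * ‖f‖ := by gcongr
    _ = _ := by ring

theorem integral_rate_le_one (hz : z ∈ U) :
    IntegrableOn (fun t => (l * γ.velocity z t).re * ‖γ.propagator z t‖) (Ioi 0) ∧
      ∫ t in Ioi (0 : ℝ), (l * γ.velocity z t).re * ‖γ.propagator z t‖ ≤ 1 := by
  obtain ⟨m, hm⟩ := γ.tendsto_exp z hz
  replace hm : Tendsto (‖γ.propagator z ·‖) atTop (𝓝 m) := by
    simpa only [norm_propagator, path] using hm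
  have hderiv : ∀ t ∈ Ici (0 : ℝ), HasDerivAt (fun t => -‖γ.propagator z t‖)
      ((l * γ.velocity z t).re * ‖γ.propagator z t‖) t :=
    fun t _ => γ.hasDerivAt_norm_propagator z t
  have hpos : ∀ t ∈ Ioi (0 : ℝ), 0 ≤ (l * γ.velocity z t).re * ‖γ.propagator z t‖ := fun t _ =>
    mul_nonneg ((mul_nonneg γ.rate_pos.le (norm_nonneg _)).trans (γ.rate_le z hz t)) (norm_nonneg _)
  refine ⟨integrableOn_Ioi_deriv_of_nonneg' hderiv hpos hm.neg, ?_⟩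
  rw [integral_Ioi_of_hasDerivAt_of_nonneg' hderiv hpos hm.neg, norm_propagator, path_zero]
  have := ge_of_tendsto' hm fun t => norm_nonneg _
  simpa using this

theorem norm_solution_le (hz : z ∈ U) : ‖γ.solution f z‖ ≤ γ.rate⁻¹ * ‖f‖ := by
  obtain ⟨hint, hle⟩ := γ.integral_rate_le_one hz
  refine (norm_integral_le_of_norm_le (hint.mul_const (γ.rate⁻¹ * ‖f‖))
    (ae_restrict_of_forall_mem measurableSet_Ioi fun t ht =>
      γ.norm_integrand_le_rate f hz (le_of_lt ht))).trans ?_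
  rw [integral_mul_const]
  exact mul_le_of_le_one_left (mul_nonneg (inv_nonneg.2 γ.rate_pos.le) (norm_nonneg f)) hle

theorem tendsto_flux (hz : z ∈ U) : Tendsto (γ.flux f z) atTop (𝓝 0) := by
  refine squeeze_zero_norm' (a := fun t => ‖γ.a t‖ * ‖γ.propagator z t‖ * ‖f‖) ?_ ?_
  · filter_upwards [eventually_ge_atTop 0] with t ht
    rw [flux, norm_smul, norm_mul, mul_comm ‖γ.propagator z t‖]
    gcongr
    exact f.norm_apply_le (γ.mem z hz t ht)
  · simpa only [norm_propagator, path, zero_mul] using (γ.tendsto_mul_exp z hz).mul_const ‖f‖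

section

variable (hU : IsOpen U)
include hU

theorem hasDerivAt_comp_path (hz : z ∈ U) (ht : 0 ≤ t) :
    HasDerivAt (fun t => f (γ.path z t)) (γ.velocity z t • deriv f (γ.path z t)) t :=
  ((f.differentiableOn.differentiableAt
    (hU.mem_nhds (γ.mem z hz t ht))).hasDerivAt.scomp t (γ.hasDerivAt_path z t) :)

theorem hasDerivAt_flux (hz : z ∈ U) (ht : 0 ≤ t) :
    HasDerivAt (γ.flux f z) ((γ.propagator z t * γ.a t) • γ.velocity z t • deriv f (γ.path z t) +
      (-(l * γ.velocity z t) * γ.propagator z t * γ.a t + γ.propagator z t * γ.a' t) •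
        f (γ.path z t)) t :=
  ((γ.hasDerivAt_propagator z t).mul (γ.hasDerivAt_a t)).smul (γ.hasDerivAt_comp_path f hU hz ht)

theorem hasDerivAt_integrand (hz : z ∈ U) (ht : 0 ≤ t) :
    HasDerivAt (γ.integrand f · t) (l • γ.integrand f z t - deriv (γ.flux f z) t) z := by
  have hpath : HasDerivAt (γ.path · t) (γ.a t) z :=
    (((hasDerivAt_id z).const_mul (γ.a t)).add_const (γ.c t)).congr_deriv (mul_one _)
  have hvel : HasDerivAt (γ.velocity · t) (γ.a' t) z :=
    (((hasDerivAt_id z).const_mul (γ.a' t)).add_const (γ.c' t)).congr_deriv (mul_one _)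
  have hprop : HasDerivAt (γ.propagator · t) (γ.propagator z t * (l * (1 - γ.a t))) z :=
    (((hasDerivAt_id z).sub hpath).const_mul l).cexp
  have hf := (f.differentiableOn.differentiableAt
    (hU.mem_nhds (γ.mem z hz t ht))).hasDerivAt.scomp z hpath
  refine ((hprop.mul hvel).neg.smul hf).congr_deriv ?_
  rw [(γ.hasDerivAt_flux f hU hz ht).deriv, integrand, ← path]
  simp only [Function.comp_apply, Pi.mul_apply, Pi.neg_apply]
  module

theorem aestronglyMeasurable_integrand (hz : z ∈ U) :
    AEStronglyMeasurable (γ.integrand f z) (volume.restrict (Ioi 0)) := by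
  refine ContinuousOn.aestronglyMeasurable (ContinuousOn.smul ?_ fun t ht =>
    (γ.hasDerivAt_comp_path f hU hz (le_of_lt ht)).continuousAt.continuousWithinAt)
    measurableSet_Ioi
  have hvel : Continuous (γ.velocity z) :=
    (γ.continuous_a'.mul continuous_const).add γ.continuous_c'
  have hprop : Continuous (γ.propagator z) :=
    continuous_iff_continuousAt.2 fun t => (γ.hasDerivAt_propagator z t).continuousAt
  exact (hprop.mul hvel).neg.continuousOn

theorem integrableOn_integrand (hz : z ∈ U) : IntegrableOn (γ.integrand f z) (Ioi 0) :=
  ((γ.integral_rate_le_one hz).1.mul_const _).mono'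
    (γ.aestronglyMeasurable_integrand f hU hz)
    (ae_restrict_of_forall_mem measurableSet_Ioi fun _ ht =>
      γ.norm_integrand_le_rate f hz (le_of_lt ht))

theorem hasDerivAt_integral_integrand [CompleteSpace E] (hz : z ∈ U) :
    IntegrableOn (fun t => deriv (γ.integrand f · t) z) (Ioi 0) ∧
      HasDerivAt (γ.solution f) (∫ t in Ioi (0 : ℝ), deriv (γ.integrand f · t) z) z := by
  obtain ⟨g, hg, hdom⟩ := γ.dominated z hz
  have hderiv : ∀ t ∈ Ioi (0 : ℝ), l • γ.integrand f z t - deriv (γ.flux f z) t =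
      deriv (γ.integrand f · t) z :=
    fun t ht => (γ.hasDerivAt_integrand f hU hz (le_of_lt ht)).deriv.symm
  refine hasDerivAt_integral_of_differentiableOn (inter_mem hdom (hU.mem_nhds hz))
    (hg.mul_const ‖f‖) (fun w hw => γ.aestronglyMeasurable_integrand f hU hw.2) ?_
    (ae_restrict_of_forall_mem measurableSet_Ioi fun t ht w hw => (γ.hasDerivAt_integrand f hU hw.2
      (le_of_lt ht)).differentiableAt.differentiableWithinAt)
    (ae_restrict_of_forall_mem measurableSet_Ioi fun t ht w hw => ?_)
  · exact (((γ.aestronglyMeasurable_integrand f hU hz).const_smul l).sub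
      (aestronglyMeasurable_deriv _ _)).congr (ae_restrict_of_forall_mem measurableSet_Ioi hderiv)
  · refine (γ.norm_integrand_le f hw.2 (le_of_lt ht)).trans ?_
    gcongr
    exact (γ.norm_propagator w t).symm ▸ hw.1 t ht

theorem hasDerivAt_solution [CompleteSpace E] (hz : z ∈ U) :
    HasDerivAt (γ.solution f) (l • γ.solution f z + f z) z := by
  obtain ⟨hint', hD⟩ := γ.hasDerivAt_integral_integrand f hU hz
  have hint : IntegrableOn (fun t => l • γ.integrand f z t) (Ioi 0) :=
    (γ.integrableOn_integrand f hU hz).smul l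
  have hflux : ∀ t ∈ Ioi (0 : ℝ), l • γ.integrand f z t - deriv (γ.integrand f · t) z =
      deriv (γ.flux f z) t := fun t ht => by
    rw [(γ.hasDerivAt_integrand f hU hz (le_of_lt ht)).deriv, sub_sub_cancel]
  have hFTC : ∫ t in Ioi (0 : ℝ), deriv (γ.flux f z) t = 0 - γ.flux f z 0 :=
    integral_Ioi_of_hasDerivAt_of_tendsto'
      (fun t ht => (γ.hasDerivAt_flux f hU hz ht).differentiableAt.hasDerivAt)
      ((integrableOn_congr_fun hflux measurableSet_Ioi).1 (hint.sub hint')) (γ.tendsto_flux f hz)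
  have hflux_zero : γ.flux f z 0 = f z := by simp [flux, propagator, path_zero, γ.a_zero]
  rw [← setIntegral_congr_fun measurableSet_Ioi hflux, integral_sub hint hint', integral_smul,
    hflux_zero, zero_sub] at hFTC
  refine hD.congr_deriv ?_
  rw [solution, ← sub_eq_zero, ← neg_eq_zero, ← sub_eq_zero.2 hFTC]
  abel

theorem differentiableOn_solution [CompleteSpace E] : DifferentiableOn ℂ (γ.solution f) U :=
  fun _ hz => (γ.hasDerivAt_solution f hU hz).differentiableAt.differentiableWithinAt

end

end DuhamelPath

/-- `K` is a bounded right inverse of `u ↦ h u' - Λ u` on bounded holomorphic functions on `U`. -/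
def IsSolutionOperator (h : ℝ) (Λ : E → E) (K : BddHol U E →L[ℂ] BddHol U E) : Prop :=
  ∀ f : BddHol U E, ∀ x ∈ U, HasDerivAt (K f) ((h : ℂ)⁻¹ • (Λ (K f x) + f x)) x

theorem DuhamelPath.exists_isSolutionOperator [CompleteSpace E] (γ : DuhamelPath U l)
    (hU : IsOpen U) :
    ∃ K : BddHol U E →L[ℂ] BddHol U E,
      IsSolutionOperator 1 (l • ·) K := by
  refine ⟨BddHol.mkCLM γ.solution γ.rate⁻¹
    (γ.differentiableOn_solution · hU)
    (fun f g x hx => ?_) (fun c f x hx => ?_) (fun f x hx => γ.norm_solution_le f hx),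
    fun f x hx => ?_⟩
  · rw [solution, solution, solution, ← integral_add (γ.integrableOn_integrand f hU hx)
      (γ.integrableOn_integrand g hU hx)]
    refine setIntegral_congr_fun measurableSet_Ioi fun t ht => ?_
    simp only [integrand, BddHol.add_apply f g (γ.mem x hx t (le_of_lt ht)), path, smul_add]
  · rw [solution, solution, ← integral_smul]
    refine setIntegral_congr_fun measurableSet_Ioi fun t ht => ?_
    simp only [integrand, BddHol.smul_apply c f (γ.mem x hx t (le_of_lt ht)), path, smul_comm c]
  · simp only [BddHol.mkCLM_apply f hx]
    refine ((γ.hasDerivAt_solution f hU hx).congr_of_eventuallyEq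
      ((hU.eventually_mem hx).mono fun w hw => BddHol.mkCLM_apply f hw)).congr_deriv ?_
    simp

end Duhamel

section Cone

variable {b : ℝ} {l : ℂ}

/-- The interior of `wedge M b`. -/
def openWedge (M b : ℝ) : Set ℂ := {x | M < x.re ∧ |x.im| < b * (x.re - M)}

theorem isOpen_openWedge (M b : ℝ) : IsOpen (openWedge M b) :=
  (isOpen_lt continuous_const Complex.continuous_re).inter
    (isOpen_lt Complex.continuous_im.abs
      (continuous_const.mul (Complex.continuous_re.sub continuous_const)))

theorem add_mem_openWedge {z w : ℂ} (hz : z ∈ openWedge 0 b) (hw : w ∈ openWedge 0 b) :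
    z + w ∈ openWedge 0 b := by
  obtain ⟨hz₁, hz₂⟩ := hz
  obtain ⟨hw₁, hw₂⟩ := hw
  refine ⟨by simpa using add_pos hz₁ hw₁, ?_⟩
  simp only [Complex.add_im, Complex.add_re]
  linarith [abs_add_le z.im w.im]

theorem ofReal_mul_mem_openWedge {t : ℝ} (ht : 0 < t) {z : ℂ} (hz : z ∈ openWedge 0 b) :
    (t : ℂ) * z ∈ openWedge 0 b := by
  obtain ⟨hz₁, hz₂⟩ := hz
  refine ⟨by simpa using mul_pos ht hz₁, ?_⟩
  simp only [Complex.im_ofReal_mul, Complex.re_ofReal_mul, abs_mul, abs_of_pos ht]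
  nlinarith

theorem re_mul_sub_ray (l z e : ℂ) (t : ℝ) :
    (l * (z - (1 * z + t * e))).re = -((l * e).re * t) := by
  rw [show l * (z - (1 * z + t * e)) = ((-t : ℝ) : ℂ) * (l * e) by push_cast; ring,
    Complex.re_ofReal_mul]
  ring

theorem tendsto_exp_neg_mul_atTop {r : ℝ} (hr : 0 < r) :
    Tendsto (fun t => Real.exp (-(r * t))) atTop (𝓝 0) :=
  Real.tendsto_exp_neg_atTop_nhds_zero.comp (tendsto_id.const_mul_atTop hr)

/-- The path `z + t e` to infinity, for a direction `e` in which `exp (-l ·)` decays. -/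
noncomputable def DuhamelPath.ray {e : ℂ} (he : e ∈ openWedge 0 b) (hle : 0 < (l * e).re) :
    DuhamelPath (openWedge 0 b) l where
  a _ := 1
  a' _ := 0
  c t := t * e
  c' _ := e
  rate := (l * e).re / ‖e‖
  continuous_a' := continuous_const
  continuous_c' := continuous_const
  hasDerivAt_a t := hasDerivAt_const t 1
  hasDerivAt_c t := by simpa using (Complex.ofRealCLM.hasDerivAt (x := t)).mul_const e
  a_zero := rfl
  c_zero := by simp
  mem z hz t ht := by
    rcases ht.eq_or_lt with rfl | ht
    · simpa using hz
    · simpa using add_mem_openWedge hz (ofReal_mul_mem_openWedge ht he)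
  rate_pos := div_pos hle (norm_pos_iff.2 (by rintro rfl; simp at hle))
  rate_le _ _ _ := by
    have he : ‖e‖ ≠ 0 := norm_ne_zero_iff.2 (by rintro rfl; simp at hle)
    simp [he]
  tendsto_exp z _ := ⟨0, by simpa only [re_mul_sub_ray] using tendsto_exp_neg_mul_atTop hle⟩
  tendsto_mul_exp z _ := by
    simp only [norm_one, re_mul_sub_ray]
    simpa using tendsto_exp_neg_mul_atTop hle
  dominated _ _ := by
    refine ⟨fun t => ‖e‖ * Real.exp (-(l * e).re * t),
      (exp_neg_integrableOn_Ioi 0 hle).const_mul _, .of_forall fun z t _ => ?_⟩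
    simp only [re_mul_sub_ray, zero_mul, zero_add, neg_mul, le_refl]

theorem mul_norm_le_neg_re_mul (hl : l.re ≤ 0) (hlb : 2 * b * |l.im| ≤ -l.re) (hb : 0 < b) {z : ℂ}
    (hz : z ∈ openWedge 0 b) : -l.re / (2 * (1 + b)) * ‖z‖ ≤ -(l * z).re := by
  obtain ⟨hz₁, hz₂⟩ := hz
  rw [sub_zero] at hz₂
  have hz : ‖z‖ ≤ (1 + b) * z.re := by
    linarith [Complex.norm_le_abs_re_add_abs_im z, abs_of_pos hz₁]
  have him : -(l.im * z.im) ≤ -l.re / 2 * z.re := calc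
    -(l.im * z.im) ≤ |l.im| * |z.im| := (neg_le_abs _).trans (abs_mul _ _).le
    _ ≤ |l.im| * (b * z.re) := by gcongr
    _ ≤ -l.re / 2 * z.re := by nlinarith
  calc -l.re / (2 * (1 + b)) * ‖z‖ ≤ -l.re / (2 * (1 + b)) * ((1 + b) * z.re) := by
        gcongr
        exact div_nonneg (by linarith) (by linarith)
    _ = -l.re / 2 * z.re := by field_simp
    _ ≤ -(l * z).re := by rw [Complex.mul_re]; linarith

theorem re_mul_sub_toVertex (l z : ℂ) (t : ℝ) :
    (l * (z - ((Real.exp (-t) : ℝ) * z + 0))).re = (1 - Real.exp (-t)) * (l * z).re := by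
  rw [show l * (z - ((Real.exp (-t) : ℝ) * z + 0)) = ((1 - Real.exp (-t) : ℝ) : ℂ) * (l * z) by
    push_cast; ring, Complex.re_ofReal_mul]

/-- The path `exp (-t) z` to the vertex. -/
noncomputable def DuhamelPath.toVertex (hl : l.re < 0) (hlb : 2 * b * |l.im| ≤ -l.re) (hb : 0 < b) :
    DuhamelPath (openWedge 0 b) l where
  a t := Real.exp (-t)
  a' t := -Real.exp (-t)
  c _ := 0
  c' _ := 0
  rate := -l.re / (2 * (1 + b))
  continuous_a' := by fun_prop
  continuous_c' := continuous_const
  hasDerivAt_a t := by simpa using (hasDerivAt_neg t).exp.ofReal_comp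
  hasDerivAt_c t := hasDerivAt_const t 0
  a_zero := by simp
  c_zero := rfl
  mem z hz t _ := by simpa using ofReal_mul_mem_openWedge (Real.exp_pos (-t)) hz
  rate_pos := div_pos (by linarith) (by linarith)
  rate_le z hz t := by
    have h := mul_le_mul_of_nonneg_left (mul_norm_le_neg_re_mul hl.le hlb hb hz)
      (Real.exp_pos (-t)).le
    rw [add_zero, ← Complex.ofReal_neg, mul_left_comm l, Complex.re_ofReal_mul, norm_mul,
      Complex.norm_real, norm_neg, Real.norm_of_nonneg (Real.exp_pos _).le]
    linarith
  tendsto_exp z _ := by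
    refine ⟨Real.exp ((1 - 0) * (l * z).re), ?_⟩
    simp only [re_mul_sub_toVertex]
    exact ((Real.tendsto_exp_neg_atTop_nhds_zero.const_sub 1).mul_const _).rexp
  tendsto_mul_exp z _ := by
    simp only [re_mul_sub_toVertex, Complex.norm_real, Real.norm_of_nonneg (Real.exp_pos _).le]
    simpa using Real.tendsto_exp_neg_atTop_nhds_zero.mul
      ((Real.tendsto_exp_neg_atTop_nhds_zero.const_sub 1).mul_const (l * z).re).rexp
  dominated z₀ hz₀ := by
    refine ⟨fun t => Real.exp (-1 * t) * (‖z₀‖ + 1),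
      (exp_neg_integrableOn_Ioi 0 one_pos).mul_const _, ?_⟩
    filter_upwards [(isOpen_openWedge 0 b).mem_nhds hz₀,
      continuous_norm.continuousAt.eventually_le_const (lt_add_one ‖z₀‖)] with z hz hzle t ht
    have hre : (l * z).re ≤ 0 := by
      have := mul_norm_le_neg_re_mul hl.le hlb hb hz
      have : 0 ≤ -l.re / (2 * (1 + b)) * ‖z‖ :=
        mul_nonneg (div_nonneg (by linarith) (by linarith)) (norm_nonneg z)
      linarith
    have hexp : Real.exp ((1 - Real.exp (-t)) * (l * z).re) ≤ 1 :=
      Real.exp_le_one_iff.2 (mul_nonpos_of_nonneg_of_nonpos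
        (sub_nonneg.2 (Real.exp_le_one_iff.2 (neg_nonpos.2 (le_of_lt ht)))) hre)
    rw [re_mul_sub_toVertex, add_zero, norm_mul, norm_neg, Complex.norm_real,
      Real.norm_of_nonneg (Real.exp_pos _).le, neg_one_mul]
    calc Real.exp (-t) * ‖z‖ * Real.exp ((1 - Real.exp (-t)) * (l * z).re)
        ≤ Real.exp (-t) * ‖z‖ * 1 := by gcongr
      _ ≤ Real.exp (-t) * (‖z₀‖ + 1) := by rw [mul_one]; gcongr

theorem exists_direction (hb : 0 < b) (hl : l ≠ 0) (hre : 0 ≤ l.re) :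
    ∃ e ∈ openWedge 0 b, 0 < (l * e).re := by
  have hpos : 0 < l.re + b / 2 * |l.im| := by
    rcases hre.eq_or_lt with h | h
    · have : l.im ≠ 0 := fun him => hl (Complex.ext h.symm him)
      rw [← h, zero_add]
      positivity
    · positivity
  refine ⟨⟨1, -(b / 2 * SignType.sign l.im)⟩, ⟨one_pos, ?_⟩, ?_⟩
  · have : |((SignType.sign l.im : SignType) : ℝ)| ≤ 1 := by
      rcases lt_trichotomy l.im 0 with h | h | h <;> simp [h]
    simp only [abs_neg, abs_mul, abs_of_pos (half_pos hb)]
    nlinarith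
  · simp only [Complex.mul_re, mul_neg, mul_one, mul_left_comm l.im, self_mul_sign]
    linarith

theorem eventually_duhamelPath (hl : l ≠ 0) :
    ∀ᶠ b in 𝓝[>] (0 : ℝ), Nonempty (DuhamelPath (openWedge 0 b) l) := by
  rcases le_or_gt 0 l.re with hre | hre
  · filter_upwards [self_mem_nhdsWithin] with b hb
    obtain ⟨e, he, hle⟩ := exists_direction hb hl hre
    exact ⟨.ray he hle⟩
  · have hlim : Tendsto (fun b : ℝ => 2 * b * |l.im|) (𝓝[>] 0) (𝓝 (2 * 0 * |l.im|)) :=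
      tendsto_nhdsWithin_of_tendsto_nhds (Continuous.tendsto (by fun_prop) 0)
    filter_upwards [self_mem_nhdsWithin, hlim.eventually_le_const (u := -l.re) (by simpa using hre)]
      with b hb hlb
    exact ⟨.toVertex hre hlb hb⟩

end Cone

section SolutionOperator

open Polynomial

variable {U : Set ℂ} {E : Type*} [NormedAddCommGroup E] [NormedSpace ℂ E]

/-- Solving one scalar equation per linear factor removes the error term
`∏ (Λ - l) (R f)` factor by factor, until the polynomial annihilates `Λ`. -/
theorem exists_solutionOperator_modulo_aeval (hU : IsOpen U) (Λ : E →L[ℂ] E) (s : Multiset ℂ)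
    (hs : ∀ l ∈ s, ∃ K : BddHol U E →L[ℂ] BddHol U E,
      IsSolutionOperator 1 (l • ·) K) :
    ∃ K R : BddHol U E →L[ℂ] BddHol U E, ∀ f, ∀ x ∈ U, HasDerivAt (K f)
      (Λ (K f x) + f x - aeval Λ (s.map fun l => X - C l).prod (R f x)) x := by
  induction s using Multiset.induction_on with
  | empty =>
    refine ⟨0, .id ℂ _, fun f x hx => ?_⟩
    simpa [BddHol.zero_apply hx] using (hasDerivAt_const x (0 : E)).congr_of_eventuallyEq
      (eventually_of_mem (hU.mem_nhds hx) fun y hy => BddHol.zero_apply hy)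
  | cons l s ih =>
    obtain ⟨K, R, hK⟩ := ih fun l' hl' => hs l' (Multiset.mem_cons_of_mem hl')
    obtain ⟨Kl, hKl⟩ := hs l (Multiset.mem_cons_self l s)
    set P : E →L[ℂ] E := aeval Λ (s.map fun l => X - C l).prod with hP
    have hadd : ∀ f, ∀ x ∈ U, (K + BddHol.postcomp P ∘L Kl ∘L R) f x = K f x + P (Kl (R f) x) :=
      fun f x hx => (BddHol.add_apply _ _ hx).trans <|
        congrArg (K f x + ·) (BddHol.postcomp_apply P (Kl (R f)) hx)
    refine ⟨K + BddHol.postcomp P ∘L Kl ∘L R, Kl ∘L R, fun f x hx => ?_⟩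
    have hderiv := (hK f x hx).add (P.hasFDerivAt.comp_hasDerivAt x (hKl (R f) x hx))
    refine (hderiv.congr_of_eventuallyEq
      (eventually_of_mem (hU.mem_nhds hx) (hadd f))).congr_deriv ?_
    rw [hadd f x hx]
    simp only [Complex.ofReal_one, inv_one, one_smul, Multiset.map_cons, Multiset.prod_cons,
      map_mul, map_add, aeval_sub, aeval_X, aeval_C, ← hP, sub_mul, sub_apply, mul_apply_eq_comp,
      ContinuousLinearMap.comp_apply,
      ContinuousLinearMap.algebraMap_apply, map_smul]
    abel

theorem ne_zero_of_mem_roots_minpoly [FiniteDimensional ℂ E] {Λ : E →L[ℂ] E}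
    (hΛ : Function.Injective Λ) {l : ℂ} (hl : l ∈ (minpoly ℂ Λ).roots) : l ≠ 0 := by
  rintro rfl
  have hint : IsIntegral ℂ Λ := Algebra.IsIntegral.isIntegral Λ
  obtain ⟨q, hq⟩ := dvd_iff_isRoot.2 (isRoot_of_mem_roots hl)
  have hq0 : aeval Λ q = 0 := ContinuousLinearMap.ext fun v => hΛ <| by
    simpa [hq] using congrArg (· v) (minpoly.aeval ℂ Λ)
  have hq_ne : q ≠ 0 := by
    rintro rfl
    exact minpoly.ne_zero hint (by simpa using hq)
  have hdeg := minpoly.degree_le_of_ne_zero ℂ Λ hq_ne hq0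
  rw [hq, degree_mul, degree_X_sub_C, degree_eq_natDegree hq_ne] at hdeg
  norm_cast at hdeg
  omega

theorem eventually_exists_isSolutionOperator [FiniteDimensional ℂ E] {Λ : E →ₗ[ℂ] E}
    (hΛ : Function.Injective Λ) :
    ∀ᶠ b in 𝓝[>] (0 : ℝ), ∃ K : BddHol (openWedge 0 b) E →L[ℂ] BddHol (openWedge 0 b) E,
      IsSolutionOperator 1 Λ K := by
  have : CompleteSpace E := FiniteDimensional.complete ℂ E
  let Λ' : E →L[ℂ] E := Λ.toContinuousLinearMap
  have hroots : ∀ᶠ b in 𝓝[>] (0 : ℝ), ∀ l ∈ (minpoly ℂ Λ').roots.toFinset,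
      Nonempty (DuhamelPath (openWedge 0 b) l) :=
    (Filter.eventually_all_finset _).2 fun l hl =>
      eventually_duhamelPath (ne_zero_of_mem_roots_minpoly hΛ (Multiset.mem_toFinset.1 hl))
  filter_upwards [hroots] with b hb
  have hU := isOpen_openWedge 0 b
  obtain ⟨K, R, hK⟩ := exists_solutionOperator_modulo_aeval hU Λ' (minpoly ℂ Λ').roots
    fun l hl => (hb l (Multiset.mem_toFinset.2 hl)).some.exists_isSolutionOperator hU
  have hprod := (IsAlgClosed.splits (minpoly ℂ Λ')).eq_prod_roots_of_monic
    (minpoly.monic (Algebra.IsIntegral.isIntegral Λ'))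
  refine ⟨K, fun f x hx => (hK f x hx).congr_deriv ?_⟩
  rw [← hprod, minpoly.aeval]
  simp [Λ']

/-- The substitution `x = M + h z` turns `h u' = Λ u + f` on `openWedge M b` into
`u' = Λ u + f` on `openWedge 0 b`, and it preserves sup norms. -/
theorem IsSolutionOperator.rescale {b : ℝ} {Λ : E → E}
    {K : BddHol (openWedge 0 b) E →L[ℂ] BddHol (openWedge 0 b) E} (hK : IsSolutionOperator 1 Λ K)
    (M : ℝ) {h : ℝ} (hh : 0 < h) :
    ∃ K' : BddHol (openWedge M b) E →L[ℂ] BddHol (openWedge M b) E,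
      IsSolutionOperator h Λ K' ∧ ‖K'‖ ≤ ‖K‖ := by
  have hh0 : (h : ℂ) ≠ 0 := mod_cast hh.ne'
  have hto : MapsTo (fun z : ℂ => M + h * z) (openWedge 0 b) (openWedge M b) := fun z hz => by
    simpa [openWedge] using ofReal_mul_mem_openWedge hh hz
  have hfrom : MapsTo (fun x : ℂ => (h : ℂ)⁻¹ * (x - M)) (openWedge M b) (openWedge 0 b) :=
    fun x hx => by
      have hx0 : x - M ∈ openWedge 0 b := by simpa [openWedge] using hx
      simpa using ofReal_mul_mem_openWedge (inv_pos.2 hh) hx0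
  have hdiff : Differentiable ℂ fun x : ℂ => (h : ℂ)⁻¹ * (x - M) := by fun_prop
  let S : BddHol (openWedge M b) E →L[ℂ] BddHol (openWedge 0 b) E :=
    BddHol.precomp (fun z => M + h * z) (by fun_prop) hto
  let S' : BddHol (openWedge 0 b) E →L[ℂ] BddHol (openWedge M b) E :=
    BddHol.precomp _ hdiff hfrom
  refine ⟨S' ∘L K ∘L S, fun f x hx => ?_, ?_⟩
  · have hz := hfrom hx
    have happ : ∀ y ∈ openWedge M b, (S' ∘L K ∘L S) f y = K (S f) ((h : ℂ)⁻¹ * (y - M)) :=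
      fun y hy => BddHol.precomp_apply hdiff hfrom (K (S f)) hy
    have hSf : S f ((h : ℂ)⁻¹ * (x - M)) = f x :=
      (BddHol.precomp_apply _ _ f hz).trans (congrArg f (by field_simp; ring))
    have hinner : HasDerivAt (fun y : ℂ => (h : ℂ)⁻¹ * (y - M)) (h : ℂ)⁻¹ x := by
      simpa using ((hasDerivAt_id x).sub_const (M : ℂ)).const_mul (h : ℂ)⁻¹
    have hderiv := (hK (S f) _ hz).scomp x hinner
    refine (hderiv.congr_of_eventuallyEq
      (eventually_of_mem ((isOpen_openWedge M b).mem_nhds hx) happ)).congr_deriv ?_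
    rw [happ x hx, hSf, Complex.ofReal_one, inv_one, one_smul]
  · calc ‖S' ∘L K ∘L S‖ ≤ ‖S'‖ * (‖K‖ * ‖S‖) :=
          (S'.opNorm_comp_le _).trans (by gcongr; exact K.opNorm_comp_le S)
      _ ≤ 1 * (‖K‖ * 1) := by gcongr <;> exact BddHol.norm_precomp_le _ _
      _ = ‖K‖ := by ring

end SolutionOperator

section Sylvester

open Polynomial

variable {ι κ : Type*} [Fintype ι] [Fintype κ]

/-- The Sylvester operator `Y ↦ B Y - Y A`, the linear part of the Riccati equation. -/
noncomputable def sylvester (A : Matrix ι ι ℂ) (B : Matrix κ κ ℂ) :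
    Matrix κ ι ℂ →ₗ[ℂ] Matrix κ ι ℂ :=
  mulLeftLinearMap ι ℂ B - mulRightLinearMap κ ℂ A

theorem sylvester_apply (A : Matrix ι ι ℂ) (B : Matrix κ κ ℂ) (Y : Matrix κ ι ℂ) :
    sylvester A B Y = B * Y - Y * A := rfl

variable [DecidableEq ι] [DecidableEq κ]

theorem aeval_mul_eq_mul_aeval {A : Matrix ι ι ℂ} {B : Matrix κ κ ℂ} {Y : Matrix κ ι ℂ}
    (hY : B * Y = Y * A) (q : ℂ[X]) : aeval B q * Y = Y * aeval A q := by
  induction q using Polynomial.induction_on' with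
  | add q r hq hr => rw [map_add, map_add, Matrix.add_mul, Matrix.mul_add, hq, hr]
  | monomial k c =>
    have hpow : B ^ k * Y = Y * A ^ k := by
      induction k with
      | zero => simp
      | succ k ih => rw [pow_succ, Matrix.mul_assoc, hY, ← Matrix.mul_assoc, ih, Matrix.mul_assoc,
          ← pow_succ]
    simp only [aeval_monomial, Algebra.algebraMap_eq_smul_one, smul_mul_assoc, one_mul,
      Matrix.smul_mul, Matrix.mul_smul, hpow]

theorem isUnit_aeval_charpoly {A : Matrix ι ι ℂ} {B : Matrix κ κ ℂ}
    (hAB : Disjoint (spectrum ℂ A) (spectrum ℂ B)) : IsUnit (aeval B A.charpoly) := by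
  by_contra hB
  rw [(IsAlgClosed.splits A.charpoly).eq_prod_roots_of_monic A.charpoly_monic] at hB
  obtain ⟨l, hlB, hlA⟩ := spectrum.exists_mem_of_not_isUnit_aeval_prod hB
  exact disjoint_left.1 hAB (Matrix.mem_spectrum_iff_isRoot_charpoly.2 hlA) hlB

theorem sylvester_injective {A : Matrix ι ι ℂ} {B : Matrix κ κ ℂ}
    (hAB : Disjoint (spectrum ℂ A) (spectrum ℂ B)) : Function.Injective (sylvester A B) := by
  refine (injective_iff_map_eq_zero _).2 fun Y hY => ?_
  have hzero : aeval B A.charpoly * Y = 0 := by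
    rw [aeval_mul_eq_mul_aeval (sub_eq_zero.1 hY), Matrix.aeval_self_charpoly,
      Matrix.mul_zero]
  rw [← Matrix.nonsing_inv_mul_cancel_left (aeval B A.charpoly) Y
    ((Matrix.isUnit_iff_isUnit_det _).1 (isUnit_aeval_charpoly hAB)), hzero, Matrix.mul_zero]

end Sylvester

section BlockMatrix

variable {ι κ ν : Type*} [Fintype ι] [Fintype κ] [Fintype ν]

theorem norm_submatrix_le {ι' κ' : Type*} [Fintype ι'] [Fintype κ'] (A : Matrix ι κ ℂ)
    (f : ι' → ι) {g : κ' → κ} (hg : Function.Injective g) : ‖A.submatrix f g‖ ≤ ‖A‖ := by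
  rw [Matrix.linfty_opNorm_def, Matrix.linfty_opNorm_def, NNReal.coe_le_coe]
  refine Finset.sup_le fun i _ => le_trans ?_ (Finset.le_sup (Finset.mem_univ (f i)))
  calc ∑ j, ‖A (f i) (g j)‖₊ = ∑ j ∈ Finset.univ.map ⟨g, hg⟩, ‖A (f i) j‖₊ := by
        rw [Finset.sum_map, Function.Embedding.coeFn_mk]
    _ ≤ ∑ j, ‖A (f i) j‖₊ := Finset.sum_le_sum_of_subset (Finset.subset_univ _)

theorem norm_toBlocks₁₁_le (Z : Matrix (ι ⊕ κ) (ι ⊕ κ) ℂ) : ‖Z.toBlocks₁₁‖ ≤ ‖Z‖ :=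
  norm_submatrix_le Z _ Sum.inl_injective

theorem norm_toBlocks₁₂_le (Z : Matrix (ι ⊕ κ) (ι ⊕ κ) ℂ) : ‖Z.toBlocks₁₂‖ ≤ ‖Z‖ :=
  norm_submatrix_le Z _ Sum.inr_injective

theorem norm_toBlocks₂₁_le (Z : Matrix (ι ⊕ κ) (ι ⊕ κ) ℂ) : ‖Z.toBlocks₂₁‖ ≤ ‖Z‖ :=
  norm_submatrix_le Z _ Sum.inl_injective

theorem norm_toBlocks₂₂_le (Z : Matrix (ι ⊕ κ) (ι ⊕ κ) ℂ) : ‖Z.toBlocks₂₂‖ ≤ ‖Z‖ :=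
  norm_submatrix_le Z _ Sum.inr_injective

theorem norm_fromBlocks_le (A : Matrix ι ι ℂ) (B : Matrix ι κ ℂ) (C : Matrix κ ι ℂ)
    (D : Matrix κ κ ℂ) : ‖Matrix.fromBlocks A B C D‖ ≤ max (‖A‖ + ‖B‖) (‖C‖ + ‖D‖) := by
  simp only [Matrix.linfty_opNorm_def, ← NNReal.coe_add, ← NNReal.coe_max, NNReal.coe_le_coe]
  refine Finset.sup_le fun i _ => ?_
  rw [Fintype.sum_sum_type]
  rcases i with i | i
  · exact le_max_of_le_left <| add_le_add
      (Finset.le_sup (f := fun i => ∑ j, ‖A i j‖₊) (Finset.mem_univ i))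
      (Finset.le_sup (f := fun i => ∑ j, ‖B i j‖₊) (Finset.mem_univ i))
  · exact le_max_of_le_right <| add_le_add
      (Finset.le_sup (f := fun i => ∑ j, ‖C i j‖₊) (Finset.mem_univ i))
      (Finset.le_sup (f := fun i => ∑ j, ‖D i j‖₊) (Finset.mem_univ i))

theorem norm_smul_one_le [DecidableEq ι] (c : ℂ) : ‖c • (1 : Matrix ι ι ℂ)‖ ≤ ‖c‖ := by
  rw [Matrix.smul_one_eq_diagonal, Matrix.linfty_opNorm_diagonal]
  exact pi_norm_const_le c

theorem isUnit_of_norm_sub_one_lt [DecidableEq ι] {T : Matrix ι ι ℂ} (hT : ‖T - 1‖ < 1) :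
    IsUnit T := by
  have h := (Units.oneSub (1 - T) (by rwa [norm_sub_rev])).isUnit
  rwa [Units.val_oneSub, sub_sub_cancel] at h

variable {U : Set ℂ}

theorem differentiableOn_matrix_mul {A : ℂ → Matrix ι κ ℂ} {B : ℂ → Matrix κ ν ℂ}
    (hA : DifferentiableOn ℂ A U) (hB : DifferentiableOn ℂ B U) :
    DifferentiableOn ℂ (fun x => A x * B x) U := by
  have hmul : IsBoundedBilinearMap ℂ fun P : Matrix ι κ ℂ × Matrix κ ν ℂ => P.1 * P.2 :=
    { add_left := Matrix.add_mul
      smul_left := Matrix.smul_mul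
      add_right := Matrix.mul_add
      smul_right := fun c A B => Matrix.mul_smul A c B
      bound := ⟨1, one_pos, fun A B => by
        simpa only [one_mul] using Matrix.linfty_opNorm_mul A B⟩ }
  exact hmul.differentiable.comp_differentiableOn (hA.prodMk hB)

theorem differentiableOn_submatrix {ι' κ' : Type*} [Fintype ι'] [Fintype κ'] (f : ι' → ι)
    (g : κ' → κ) {Z : ℂ → Matrix ι κ ℂ} (hZ : DifferentiableOn ℂ Z U) :
    DifferentiableOn ℂ (fun x => (Z x).submatrix f g) U :=
  let S : Matrix ι κ ℂ →ₗ[ℂ] Matrix ι' κ' ℂ :=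
    { toFun := fun Z => Z.submatrix f g
      map_add' := fun _ _ => rfl
      map_smul' := fun _ _ => rfl }
  S.toContinuousLinearMap.differentiable.comp_differentiableOn hZ

/-- Assembling a matrix from its blocks, as a continuous linear map. -/
noncomputable def fromBlocksCLM (ι κ : Type*) [Fintype ι] [Fintype κ] :
    (Matrix ι ι ℂ × Matrix ι κ ℂ × Matrix κ ι ℂ × Matrix κ κ ℂ) →L[ℂ]
      Matrix (ι ⊕ κ) (ι ⊕ κ) ℂ :=
  LinearMap.toContinuousLinearMap
    { toFun := fun P => Matrix.fromBlocks P.1 P.2.1 P.2.2.1 P.2.2.2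
      map_add' := fun _ _ => (Matrix.fromBlocks_add ..).symm
      map_smul' := fun _ _ => (Matrix.fromBlocks_smul ..).symm }

theorem hasDerivAt_fromBlocks {A : ℂ → Matrix ι ι ℂ} {B : ℂ → Matrix ι κ ℂ}
    {C : ℂ → Matrix κ ι ℂ} {D : ℂ → Matrix κ κ ℂ} {A' : Matrix ι ι ℂ} {B' : Matrix ι κ ℂ}
    {C' : Matrix κ ι ℂ} {D' : Matrix κ κ ℂ} {x : ℂ} (hA : HasDerivAt A A' x)
    (hB : HasDerivAt B B' x) (hC : HasDerivAt C C' x) (hD : HasDerivAt D D' x) :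
    HasDerivAt (fun x => Matrix.fromBlocks (A x) (B x) (C x) (D x))
      (Matrix.fromBlocks A' B' C' D') x :=
  (fromBlocksCLM ι κ).hasFDerivAt.comp_hasDerivAt x (hA.prodMk (hB.prodMk (hC.prodMk hD)))

theorem differentiableOn_fromBlocks {A : ℂ → Matrix ι ι ℂ} {B : ℂ → Matrix ι κ ℂ}
    {C : ℂ → Matrix κ ι ℂ} {D : ℂ → Matrix κ κ ℂ} (hA : DifferentiableOn ℂ A U)
    (hB : DifferentiableOn ℂ B U) (hC : DifferentiableOn ℂ C U) (hD : DifferentiableOn ℂ D U) :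
    DifferentiableOn ℂ (fun x => Matrix.fromBlocks (A x) (B x) (C x) (D x)) U :=
  (fromBlocksCLM ι κ).differentiable.comp_differentiableOn
    (hA.prodMk (hB.prodMk (hC.prodMk hD)))

end BlockMatrix

section Riccati

variable {ι κ : Type*} [Fintype ι] [Fintype κ]

/-- The vector field of the Riccati equation `h y' = riccati (Z x) y`, which says that the graph
`{(v, y v)}` is invariant under the linear system `h W' = Z W`. -/
def riccati (Z : Matrix (ι ⊕ κ) (ι ⊕ κ) ℂ) (y : Matrix κ ι ℂ) : Matrix κ ι ℂ :=
  Z.toBlocks₂₁ + Z.toBlocks₂₂ * y - y * Z.toBlocks₁₁ - y * Z.toBlocks₁₂ * y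

theorem riccati_zero_right (Z : Matrix (ι ⊕ κ) (ι ⊕ κ) ℂ) : riccati Z 0 = Z.toBlocks₂₁ := by
  simp [riccati]

theorem riccati_fromBlocks (A : Matrix ι ι ℂ) (B : Matrix ι κ ℂ) (C : Matrix κ ι ℂ)
    (D : Matrix κ κ ℂ) (y : Matrix κ ι ℂ) :
    riccati (Matrix.fromBlocks A B C D) y = C + D * y - y * A - y * B * y := by
  simp only [riccati, Matrix.toBlocks_fromBlocks₁₁, Matrix.toBlocks_fromBlocks₁₂,
    Matrix.toBlocks_fromBlocks₂₁, Matrix.toBlocks_fromBlocks₂₂]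

theorem riccati_add_left (Z Z' : Matrix (ι ⊕ κ) (ι ⊕ κ) ℂ) (y : Matrix κ ι ℂ) :
    riccati (Z + Z') y = riccati Z y + riccati Z' y := by
  have h₁₁ : (Z + Z').toBlocks₁₁ = Z.toBlocks₁₁ + Z'.toBlocks₁₁ := rfl
  have h₁₂ : (Z + Z').toBlocks₁₂ = Z.toBlocks₁₂ + Z'.toBlocks₁₂ := rfl
  have h₂₁ : (Z + Z').toBlocks₂₁ = Z.toBlocks₂₁ + Z'.toBlocks₂₁ := rfl
  have h₂₂ : (Z + Z').toBlocks₂₂ = Z.toBlocks₂₂ + Z'.toBlocks₂₂ := rfl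
  simp only [riccati, h₁₁, h₁₂, h₂₁, h₂₂, Matrix.add_mul, Matrix.mul_add]
  abel

theorem riccati_fromBlocks_diagonal (A : Matrix ι ι ℂ) (D : Matrix κ κ ℂ) (y : Matrix κ ι ℂ) :
    riccati (Matrix.fromBlocks A 0 0 D) y = sylvester A D y := by
  simp [riccati_fromBlocks, sylvester_apply]

theorem riccati_add_right (Z : Matrix (ι ⊕ κ) (ι ⊕ κ) ℂ) (a w : Matrix κ ι ℂ) :
    riccati Z (a + w) = riccati Z a + (Z.toBlocks₂₂ - a * Z.toBlocks₁₂) * w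
      - w * (Z.toBlocks₁₁ + Z.toBlocks₁₂ * a) - w * Z.toBlocks₁₂ * w := by
  simp only [riccati, Matrix.add_mul, Matrix.mul_add, Matrix.sub_mul, Matrix.mul_assoc]
  abel

theorem norm_riccati_sub_le (Z : Matrix (ι ⊕ κ) (ι ⊕ κ) ℂ) (y w : Matrix κ ι ℂ) :
    ‖riccati Z y - riccati Z w‖ ≤
      (‖Z.toBlocks₁₁‖ + ‖Z.toBlocks₂₂‖ + (‖y‖ + ‖w‖) * ‖Z.toBlocks₁₂‖) * ‖y - w‖ := by
  have hsub : riccati Z y - riccati Z w =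
      Z.toBlocks₂₂ * (y - w) - (y - w) * Z.toBlocks₁₁ - y * Z.toBlocks₁₂ * (y - w)
        - (y - w) * Z.toBlocks₁₂ * w := by
    simp only [riccati, Matrix.mul_sub, Matrix.sub_mul]
    abel
  calc ‖riccati Z y - riccati Z w‖
      ≤ ‖Z.toBlocks₂₂‖ * ‖y - w‖ + ‖y - w‖ * ‖Z.toBlocks₁₁‖
        + ‖y‖ * ‖Z.toBlocks₁₂‖ * ‖y - w‖ + ‖y - w‖ * ‖Z.toBlocks₁₂‖ * ‖w‖ := by
        rw [hsub]
        refine (norm_sub_le _ _).trans (add_le_add ((norm_sub_le _ _).trans (add_le_add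
          ((norm_sub_le _ _).trans (add_le_add ?_ ?_)) ?_)) ?_)
        · exact Matrix.linfty_opNorm_mul _ _
        · exact Matrix.linfty_opNorm_mul _ _
        · exact (Matrix.linfty_opNorm_mul _ _).trans
            (by gcongr; exact Matrix.linfty_opNorm_mul _ _)
        · exact (Matrix.linfty_opNorm_mul _ _).trans
            (by gcongr; exact Matrix.linfty_opNorm_mul _ _)
    _ = _ := by ring

theorem norm_riccati_le (Z : Matrix (ι ⊕ κ) (ι ⊕ κ) ℂ) (y : Matrix κ ι ℂ) :
    ‖riccati Z y‖ ≤ ‖Z.toBlocks₂₁‖ +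
      (‖Z.toBlocks₁₁‖ + ‖Z.toBlocks₂₂‖ + ‖y‖ * ‖Z.toBlocks₁₂‖) * ‖y‖ := by
  have h := norm_riccati_sub_le Z y 0
  rw [riccati_zero_right, norm_zero, add_zero, sub_zero] at h
  exact (norm_le_norm_add_norm_sub' _ _).trans (by gcongr)

theorem differentiableOn_riccati {U : Set ℂ} {Z : ℂ → Matrix (ι ⊕ κ) (ι ⊕ κ) ℂ}
    {y : ℂ → Matrix κ ι ℂ} (hZ : DifferentiableOn ℂ Z U) (hy : DifferentiableOn ℂ y U) :
    DifferentiableOn ℂ (fun x => riccati (Z x) (y x)) U := by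
  have h₁₁ := differentiableOn_submatrix Sum.inl Sum.inl hZ
  have h₁₂ := differentiableOn_submatrix Sum.inl Sum.inr hZ
  have h₂₁ := differentiableOn_submatrix Sum.inr Sum.inl hZ
  have h₂₂ := differentiableOn_submatrix Sum.inr Sum.inr hZ
  exact ((h₂₁.add (differentiableOn_matrix_mul h₂₂ hy)).sub
    (differentiableOn_matrix_mul hy h₁₁)).sub
    (differentiableOn_matrix_mul (differentiableOn_matrix_mul hy h₁₂) hy)

theorem exists_fixedPoint_of_half_lipschitzOn {X : Type*} [NormedAddCommGroup X] [CompleteSpace X]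
    {F : X → X} {r : ℝ} (hr : 2 * ‖F 0‖ ≤ r)
    (hF : ∀ x y, ‖x‖ ≤ r → ‖y‖ ≤ r → ‖F x - F y‖ ≤ 1 / 2 * ‖x - y‖) :
    ∃ x, F x = x ∧ ‖x‖ ≤ 2 * ‖F 0‖ := by
  have hr0 : 0 ≤ r := (by positivity : 0 ≤ 2 * ‖F 0‖).trans hr
  have hgrowth : ∀ x, ‖x‖ ≤ r → ‖F x‖ ≤ 1 / 2 * ‖x‖ + ‖F 0‖ := fun x hx => by
    have h := (norm_le_norm_sub_add (F x) (F 0)).trans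
      (add_le_add_left (hF x 0 hx (by simpa using hr0)) _)
    rwa [sub_zero] at h
  have hmaps : MapsTo F (Metric.closedBall 0 r) (Metric.closedBall 0 r) := fun x hx => by
    rw [mem_closedBall_zero_iff] at hx ⊢
    linarith [hgrowth x hx]
  have hcontr : ContractingWith (1 / 2) (hmaps.restrict F _ _) :=
    ⟨by rw [← NNReal.coe_lt_coe]; norm_num, LipschitzWith.of_dist_le_mul fun x y => by
      simpa only [Subtype.dist_eq, dist_eq_norm] using!
        hF x y (mem_closedBall_zero_iff.1 x.2) (mem_closedBall_zero_iff.1 y.2)⟩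
  obtain ⟨x, hx, hfix, -⟩ := hcontr.exists_fixedPoint' Metric.isClosed_closedBall.isComplete hmaps
    (Metric.mem_closedBall_self hr0) (edist_ne_top _ _)
  rw [mem_closedBall_zero_iff] at hx
  have h := hgrowth x hx
  rw [hfix.eq] at h
  exact ⟨x, hfix, by linarith⟩

theorem exists_riccati_equilibrium {Λ S : Matrix κ ι ℂ →ₗ[ℂ] Matrix κ ι ℂ} {C δ : ℝ} (hC : 0 ≤ C)
    (hS : ∀ c, Λ (S c) = c) (hSC : ∀ c, ‖S c‖ ≤ C * ‖c‖) {Z : Matrix (ι ⊕ κ) (ι ⊕ κ) ℂ}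
    (hδ : ‖Z.toBlocks₁₁‖ + ‖Z.toBlocks₂₂‖ + 2 * ‖Z.toBlocks₁₂‖ ≤ δ) (hCδ : C * δ ≤ 1 / 2)
    (hγ : 2 * (C * ‖Z.toBlocks₂₁‖) ≤ 1) :
    ∃ a, Λ a + riccati Z a = 0 ∧ ‖a‖ ≤ 2 * (C * ‖Z.toBlocks₂₁‖) := by
  have hF0 : ‖-S (riccati Z 0)‖ ≤ C * ‖Z.toBlocks₂₁‖ := by
    rw [norm_neg, riccati_zero_right]
    exact hSC _
  have hlip : ∀ y w, ‖y‖ ≤ 1 → ‖w‖ ≤ 1 →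
      ‖-S (riccati Z y) - -S (riccati Z w)‖ ≤ 1 / 2 * ‖y - w‖ := fun y w hy hw => by
    rw [neg_sub_neg, norm_sub_rev, ← map_sub]
    calc ‖S (riccati Z y - riccati Z w)‖ ≤ C * ‖riccati Z y - riccati Z w‖ :=
          hSC _
      _ ≤ C * (δ * ‖y - w‖) := by
          gcongr
          refine (norm_riccati_sub_le Z y w).trans ?_
          gcongr
          refine le_trans ?_ hδ
          gcongr
          linarith
      _ ≤ 1 / 2 * ‖y - w‖ := by rw [← mul_assoc]; gcongr
  obtain ⟨a, ha, hle⟩ := exists_fixedPoint_of_half_lipschitzOn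
    (F := fun y => -S (riccati Z y)) (r := 1) (by linarith) hlip
  refine ⟨a, ?_, hle.trans (by linarith)⟩
  have hΛa : Λ a = -Λ (S (riccati Z a)) := (congrArg Λ ha.symm).trans (map_neg Λ _)
  rw [hΛa, hS, neg_add_cancel]

end Riccati

section SemilinearEquation

variable {U : Set ℂ} {E : Type*} [NormedAddCommGroup E] [NormedSpace ℂ E] [CompleteSpace E]

theorem exists_bounded_semilinear_solution (hU : IsOpen U) {h C γ : ℝ} {Λ : E → E}
    {K : BddHol U E →L[ℂ] BddHol U E} (hK : IsSolutionOperator h Λ K) (hC : ‖K‖ ≤ C)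
    {G : ℂ → E → E}
    (hG : ∀ y : ℂ → E, DifferentiableOn ℂ y U → DifferentiableOn ℂ (fun x => G x (y x)) U)
    (hbdd : ∀ r, ∃ B, ∀ x ∈ U, ∀ y, ‖y‖ ≤ r → ‖G x y‖ ≤ B)
    (hγ0 : 0 ≤ γ) (hγ : ∀ x ∈ U, ‖G x 0‖ ≤ γ) (hCγ : 2 * (C * γ) ≤ 1)
    (hlip : ∀ x ∈ U, ∀ y w, ‖y‖ ≤ 1 → ‖w‖ ≤ 1 → C * ‖G x y - G x w‖ ≤ 1 / 2 * ‖y - w‖) :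
    ∃ v : ℂ → E, (∀ x ∈ U, HasDerivAt v ((h : ℂ)⁻¹ • (Λ (v x) + G x (v x))) x) ∧
      ∀ x ∈ U, ‖v x‖ ≤ 2 * (C * γ) := by
  have hcomplete : CompleteSpace (BddHol U E) := BddHol.completeSpace hU
  have hC0 : 0 ≤ C := (norm_nonneg K).trans hC
  let N : BddHol U E → BddHol U E := fun v => BddHol.of (fun x => G x (v x))
    (hG v v.differentiableOn)
    ((hbdd ‖v‖).imp fun B hB x hx => hB x hx _ (v.norm_apply_le hx))
  have hN : ∀ v, ∀ x ∈ U, N v x = G x (v x) := fun v x hx =>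
    BddHol.of_apply (hf := hG v v.differentiableOn) hx
  have hN0 : ‖N 0‖ ≤ γ := BddHol.norm_le hγ0 fun x hx => by
    rw [hN 0 x hx, BddHol.zero_apply hx]
    exact hγ x hx
  have hKN : ∀ v w, ‖v‖ ≤ 1 → ‖w‖ ≤ 1 → ‖K (N v) - K (N w)‖ ≤ 1 / 2 * ‖v - w‖ :=
    fun v w hv hw => by
      have hsub : ‖(C : ℂ) • (N v - N w)‖ ≤ 1 / 2 * ‖v - w‖ :=
        BddHol.norm_le (by positivity) fun x hx => by
          rw [BddHol.smul_apply _ _ hx, BddHol.sub_apply _ _ hx, hN v x hx, hN w x hx, norm_smul,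
            Complex.norm_of_nonneg hC0]
          refine (hlip x hx _ _ ((v.norm_apply_le hx).trans hv)
            ((w.norm_apply_le hx).trans hw)).trans ?_
          rw [← BddHol.sub_apply _ _ hx]
          gcongr
          exact (v - w).norm_apply_le hx
      rw [norm_smul, Complex.norm_of_nonneg hC0] at hsub
      rw [← map_sub]
      exact (K.le_of_opNorm_le hC _).trans hsub
  have hKN0 : ‖K (N 0)‖ ≤ C * γ := (K.le_of_opNorm_le hC _).trans (by gcongr)
  obtain ⟨v, hv, hle⟩ := exists_fixedPoint_of_half_lipschitzOn (F := fun v => K (N v)) (r := 1)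
    (by linarith) hKN
  refine ⟨v, fun x hx => ?_, fun x hx => (v.norm_apply_le hx).trans (by linarith)⟩
  have hderiv := hK (N v) x hx
  rwa [hv, hN v x hx] at hderiv

end SemilinearEquation

section RiccatiSolution

variable {ι κ : Type*} [Fintype ι] [Fintype κ] {U : Set ℂ} {h C : ℝ}
  {Λ : Matrix κ ι ℂ →ₗ[ℂ] Matrix κ ι ℂ}
  {K : BddHol U (Matrix κ ι ℂ) →L[ℂ] BddHol U (Matrix κ ι ℂ)}

theorem exists_bounded_riccati_solution (hU : IsOpen U) (hK : IsSolutionOperator h Λ K)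
    (hC : ‖K‖ ≤ C) {Z : ℂ → Matrix (ι ⊕ κ) (ι ⊕ κ) ℂ} (hZ : DifferentiableOn ℂ Z U) {δ γ : ℝ}
    (hδ : ∀ x ∈ U, ‖(Z x).toBlocks₁₁‖ + ‖(Z x).toBlocks₂₂‖ + 2 * ‖(Z x).toBlocks₁₂‖ ≤ δ)
    (hCδ : C * δ ≤ 1 / 2) (hγ0 : 0 ≤ γ) (hγ : ∀ x ∈ U, ‖(Z x).toBlocks₂₁‖ ≤ γ)
    (hCγ : 2 * (C * γ) ≤ 1) :
    ∃ v : ℂ → Matrix κ ι ℂ,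
      (∀ x ∈ U, HasDerivAt v ((h : ℂ)⁻¹ • (Λ (v x) + riccati (Z x) (v x))) x) ∧
      ∀ x ∈ U, ‖v x‖ ≤ 2 * (C * γ) := by
  refine exists_bounded_semilinear_solution hU hK hC
    (fun y hy => differentiableOn_riccati hZ hy) (fun r => ⟨γ + (δ + r * δ) * r, ?_⟩) hγ0
    (fun x hx => (congrArg norm (riccati_zero_right (Z x))).trans_le (hγ x hx)) hCγ
    fun x hx y w hy hw => ?_
  · intro x hx y hy
    have hδx := hδ x hx
    have hr : 0 ≤ r := (norm_nonneg y).trans hy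
    have hn₁₁ := norm_nonneg (Z x).toBlocks₁₁
    have hn₁₂ := norm_nonneg (Z x).toBlocks₁₂
    have hn₂₂ := norm_nonneg (Z x).toBlocks₂₂
    have hδ0 : 0 ≤ δ := by linarith
    calc ‖riccati (Z x) y‖ ≤ ‖(Z x).toBlocks₂₁‖ + (‖(Z x).toBlocks₁₁‖ + ‖(Z x).toBlocks₂₂‖
          + ‖y‖ * ‖(Z x).toBlocks₁₂‖) * ‖y‖ := norm_riccati_le (Z x) y
      _ ≤ γ + (δ + r * δ) * r := by
          gcongr
          · exact hγ x hx
          · linarith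
          · linarith
  · calc C * ‖riccati (Z x) y - riccati (Z x) w‖ ≤ C * (δ * ‖y - w‖) := by
          have hC0 : 0 ≤ C := (norm_nonneg K).trans hC
          gcongr
          refine (norm_riccati_sub_le (Z x) y w).trans ?_
          gcongr
          refine le_trans ?_ (hδ x hx)
          gcongr
          linarith
      _ ≤ 1 / 2 * ‖y - w‖ := by rw [← mul_assoc]; gcongr

end RiccatiSolution

section ConvergentRiccatiSolution

variable {ι κ : Type*} [Fintype ι] [Fintype κ] [DecidableEq κ]

/-- The coefficient of the Riccati equation satisfied by `v` when `y = a + s v` solves the one with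
coefficient `Z`, where `s` is a scalar with `h s' = -μ s` and `a` is an equilibrium of the one with
coefficient `Zinf`. -/
noncomputable def rescaledCoeff (Z Zinf : Matrix (ι ⊕ κ) (ι ⊕ κ) ℂ) (a : Matrix κ ι ℂ) (s μ : ℂ) :
    Matrix (ι ⊕ κ) (ι ⊕ κ) ℂ :=
  Matrix.fromBlocks (Z.toBlocks₁₁ + Z.toBlocks₁₂ * a) (s • Z.toBlocks₁₂)
    (s⁻¹ • riccati (Z - Zinf) a) (Z.toBlocks₂₂ - a * Z.toBlocks₁₂ + μ • 1)

theorem riccati_add_smul (Z Zinf : Matrix (ι ⊕ κ) (ι ⊕ κ) ℂ) (a v : Matrix κ ι ℂ) {s : ℂ}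
    (hs : s ≠ 0) (μ : ℂ) :
    riccati Z (a + s • v) =
      riccati Zinf a + s • riccati (rescaledCoeff Z Zinf a s μ) v - (μ * s) • v := by
  have hsplit : riccati Z a = riccati (Z - Zinf) a + riccati Zinf a := by
    rw [← riccati_add_left, sub_add_cancel]
  rw [rescaledCoeff, riccati_fromBlocks, riccati_add_right, hsplit]
  simp only [smul_sub, smul_add, smul_inv_smul₀ hs, Matrix.add_mul, Matrix.smul_mul,
    Matrix.mul_smul, Matrix.one_mul, smul_smul, mul_comm μ s]
  abel

theorem norm_rescaledCoeff_blocks_le {Z Zinf : Matrix (ι ⊕ κ) (ι ⊕ κ) ℂ} {a : Matrix κ ι ℂ}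
    {s μ : ℂ} {ε : ℝ} (hZ : ‖Z‖ ≤ ε) (ha : ‖a‖ ≤ 1) (hs : ‖s‖ ≤ 1) :
    ‖(rescaledCoeff Z Zinf a s μ).toBlocks₁₁‖ + ‖(rescaledCoeff Z Zinf a s μ).toBlocks₂₂‖
      + 2 * ‖(rescaledCoeff Z Zinf a s μ).toBlocks₁₂‖ ≤ 6 * ε + ‖μ‖ := by
  have hε : 0 ≤ ε := (norm_nonneg Z).trans hZ
  have h₁₂ := (norm_toBlocks₁₂_le Z).trans hZ
  have h₁₁ : ‖Z.toBlocks₁₁ + Z.toBlocks₁₂ * a‖ ≤ ε + ε * 1 :=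
    (norm_add_le _ _).trans <| add_le_add ((norm_toBlocks₁₁_le Z).trans hZ) <|
      (Matrix.linfty_opNorm_mul _ _).trans (by gcongr)
  have h₂₂ : ‖Z.toBlocks₂₂ - a * Z.toBlocks₁₂ + μ • 1‖ ≤ ε + 1 * ε + ‖μ‖ :=
    (norm_add_le _ _).trans <| add_le_add ((norm_sub_le _ _).trans <|
      add_le_add ((norm_toBlocks₂₂_le Z).trans hZ) <|
        (Matrix.linfty_opNorm_mul _ _).trans (by gcongr)) (norm_smul_one_le μ)
  have hs₁₂ : ‖s • Z.toBlocks₁₂‖ ≤ 1 * ε := (norm_smul_le _ _).trans (by gcongr)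
  simp only [rescaledCoeff, Matrix.toBlocks_fromBlocks₁₁, Matrix.toBlocks_fromBlocks₁₂,
    Matrix.toBlocks_fromBlocks₂₂]
  linarith

theorem norm_rescaledCoeff_toBlocks₂₁_le {Z Zinf : Matrix (ι ⊕ κ) (ι ⊕ κ) ℂ} {a : Matrix κ ι ℂ}
    {s μ : ℂ} {σ γ : ℝ} (ha : ‖a‖ ≤ 1) (hs : s ≠ 0) (hZ : ‖Z - Zinf‖ ≤ σ * ‖s‖)
    (hγ : ‖(Z - Zinf).toBlocks₂₁‖ ≤ γ * ‖s‖) :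
    ‖(rescaledCoeff Z Zinf a s μ).toBlocks₂₁‖ ≤ γ + 3 * σ * ‖a‖ := by
  have hs0 : 0 < ‖s‖ := norm_pos_iff.2 hs
  rw [rescaledCoeff, Matrix.toBlocks_fromBlocks₂₁, norm_smul, norm_inv, inv_mul_le_iff₀ hs0]
  calc ‖riccati (Z - Zinf) a‖
      ≤ γ * ‖s‖ + (σ * ‖s‖ + σ * ‖s‖ + 1 * (σ * ‖s‖)) * ‖a‖ := by
        refine (norm_riccati_le _ _).trans ?_
        gcongr
        · exact (norm_toBlocks₁₁_le _).trans hZ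
        · exact (norm_toBlocks₂₂_le _).trans hZ
        · exact (norm_toBlocks₁₂_le _).trans hZ
    _ = ‖s‖ * (γ + 3 * σ * ‖a‖) := by ring

theorem differentiableOn_rescaledCoeff {U : Set ℂ} {Z : ℂ → Matrix (ι ⊕ κ) (ι ⊕ κ) ℂ}
    (hZ : DifferentiableOn ℂ Z U) (Zinf : Matrix (ι ⊕ κ) (ι ⊕ κ) ℂ) (a : Matrix κ ι ℂ)
    {s : ℂ → ℂ} (hs : DifferentiableOn ℂ s U) (hs0 : ∀ x ∈ U, s x ≠ 0) (μ : ℂ) :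
    DifferentiableOn ℂ (fun x => rescaledCoeff (Z x) Zinf a (s x) μ) U := by
  have h₁₂ := differentiableOn_submatrix Sum.inl Sum.inr hZ
  have ha := differentiableOn_const (𝕜 := ℂ) (s := U) a
  exact differentiableOn_fromBlocks
    ((differentiableOn_submatrix Sum.inl Sum.inl hZ).add (differentiableOn_matrix_mul h₁₂ ha))
    (hs.smul h₁₂)
    ((hs.inv hs0).smul (differentiableOn_riccati (hZ.sub (differentiableOn_const Zinf)) ha))
    (((differentiableOn_submatrix Sum.inr Sum.inr hZ).sub
      (differentiableOn_matrix_mul ha h₁₂)).add (differentiableOn_const _))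

theorem hasDerivAt_add_smul_of_rescaledCoeff {Λ : Matrix κ ι ℂ →ₗ[ℂ] Matrix κ ι ℂ}
    {Z Zinf : Matrix (ι ⊕ κ) (ι ⊕ κ) ℂ} {a : Matrix κ ι ℂ} (ha : Λ a + riccati Zinf a = 0)
    {h η x : ℂ} (hh : h ≠ 0) {s : ℂ → ℂ} (hs0 : s x ≠ 0) (hs : HasDerivAt s (-η * s x) x)
    {v : ℂ → Matrix κ ι ℂ}
    (hv : HasDerivAt v (h⁻¹ • (Λ (v x) + riccati (rescaledCoeff Z Zinf a (s x) (h * η)) (v x))) x) :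
    HasDerivAt (fun x => a + s x • v x)
      (h⁻¹ • (Λ (a + s x • v x) + riccati Z (a + s x • v x))) x := by
  refine ((hs.smul hv).const_add a).congr_deriv ?_
  rw [riccati_add_smul Z Zinf a (v x) hs0 (h * η), map_add, map_smul,
    eq_neg_of_add_eq_zero_left ha]
  have hcancel : h⁻¹ * (h * η * s x) = η * s x := by field_simp
  simp only [smul_add, smul_sub, smul_neg, smul_smul, hcancel, mul_comm h⁻¹, neg_mul, neg_smul]
  abel

theorem hasDerivAt_cexp_const_mul (c x : ℂ) :
    HasDerivAt (fun x => Complex.exp (c * x)) (c * Complex.exp (c * x)) x := by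
  simpa only [mul_one, mul_comm] using! ((hasDerivAt_id x).const_mul c).cexp

theorem norm_cexp_neg_ofReal_mul (η : ℝ) (x : ℂ) :
    ‖Complex.exp (-η * x)‖ = Real.exp (-η * x.re) := by
  simp [Complex.norm_exp]

omit [DecidableEq κ] in
theorem exists_convergent_riccati_solution {U : Set ℂ} {h C η ε σ γ : ℝ}
    {Λ S : Matrix κ ι ℂ →ₗ[ℂ] Matrix κ ι ℂ}
    {K : BddHol U (Matrix κ ι ℂ) →L[ℂ] BddHol U (Matrix κ ι ℂ)}
    (hU : IsOpen U) (hre : ∀ x ∈ U, 0 ≤ x.re) (hh : 0 < h) (hη : 0 ≤ η)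
    (hK : IsSolutionOperator h Λ K) (hKC : ‖K‖ ≤ C) (hS : ∀ c, Λ (S c) = c)
    (hSC : ∀ c, ‖S c‖ ≤ C * ‖c‖)
    {Z : ℂ → Matrix (ι ⊕ κ) (ι ⊕ κ) ℂ} {Zinf : Matrix (ι ⊕ κ) (ι ⊕ κ) ℂ}
    (hZ : DifferentiableOn ℂ Z U) (hZε : ∀ x ∈ U, ‖Z x‖ ≤ ε) (hZinfε : ‖Zinf‖ ≤ ε)
    (hZσ : ∀ x ∈ U, ‖Z x - Zinf‖ ≤ σ * Real.exp (-η * x.re))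
    (hγ : ∀ x ∈ U, ‖(Z x - Zinf).toBlocks₂₁‖ ≤ γ * Real.exp (-η * x.re))
    (hinfγ : ‖Zinf.toBlocks₂₁‖ ≤ γ) (hCε : C * (6 * ε + h * η) ≤ 1 / 2) (hσ0 : 0 ≤ σ)
    (hCγ : 2 * (C * (γ * (1 + 6 * C * σ))) ≤ 1) :
    ∃ (y : ℂ → Matrix κ ι ℂ) (a : Matrix κ ι ℂ),
      (∀ x ∈ U, HasDerivAt y ((h : ℂ)⁻¹ • (Λ (y x) + riccati (Z x) (y x))) x) ∧
      ‖a‖ ≤ 2 * (C * ‖Zinf.toBlocks₂₁‖) ∧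
      ∀ x ∈ U, ‖y x - a‖ ≤ 2 * (C * (γ * (1 + 6 * C * σ))) * Real.exp (-η * x.re) := by
  classical
  have hC0 : 0 ≤ C := (norm_nonneg K).trans hKC
  have hγ0 : 0 ≤ γ := (norm_nonneg _).trans hinfγ
  have hε0 : 0 ≤ ε := (norm_nonneg _).trans hZinfε
  have hCγ1 : 2 * (C * γ) ≤ 1 := by
    refine le_trans ?_ hCγ
    gcongr
    exact le_mul_of_one_le_right hγ0 (le_add_of_nonneg_right (by positivity))
  obtain ⟨a, ha, haC⟩ := exists_riccati_equilibrium (Z := Zinf) (δ := 6 * ε + h * η) hC0 hS hSC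
    (by linarith [norm_toBlocks₁₁_le Zinf, norm_toBlocks₂₂_le Zinf, norm_toBlocks₁₂_le Zinf,
      mul_nonneg hh.le hη]) hCε (le_trans (by gcongr) hCγ1)
  have haγ : ‖a‖ ≤ 2 * (C * γ) := haC.trans (by gcongr)
  have ha1 : ‖a‖ ≤ 1 := haγ.trans hCγ1
  let s : ℂ → ℂ := fun x => Complex.exp (-η * x)
  have hs0 : ∀ x, s x ≠ 0 := fun x => Complex.exp_ne_zero _
  have hs : ∀ x, HasDerivAt s (-η * s x) x := hasDerivAt_cexp_const_mul (-η)
  have hnorm_s : ∀ x, ‖s x‖ = Real.exp (-η * x.re) := norm_cexp_neg_ofReal_mul η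
  have hs1 : ∀ x ∈ U, ‖s x‖ ≤ 1 := fun x hx => by
    rw [hnorm_s, Real.exp_le_one_iff]
    exact mul_nonpos_of_nonpos_of_nonneg (neg_nonpos.2 hη) (hre x hx)
  simp only [← hnorm_s] at hZσ hγ ⊢
  obtain ⟨v, hv, hvC⟩ := exists_bounded_riccati_solution hU hK hKC
    (differentiableOn_rescaledCoeff hZ Zinf a
      (fun x _ => (hs x).differentiableAt.differentiableWithinAt) (fun x _ => hs0 x) (h * η : ℝ))
    (fun x hx => (norm_rescaledCoeff_blocks_le (hZε x hx) ha1 (hs1 x hx)).trans_eq <| by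
      rw [Complex.norm_of_nonneg (by positivity)])
    hCε (by positivity)
    (fun x hx => (norm_rescaledCoeff_toBlocks₂₁_le ha1 (hs0 x) (hZσ x hx) (hγ x hx)).trans <| by
        calc γ + 3 * σ * ‖a‖ ≤ γ + 3 * σ * (2 * (C * γ)) := by gcongr
          _ = γ * (1 + 6 * C * σ) := by ring) hCγ
  refine ⟨fun x => a + s x • v x, a, fun x hx => ?_, haC, fun x hx => ?_⟩
  · exact hasDerivAt_add_smul_of_rescaledCoeff ha (mod_cast hh.ne') (hs0 x) (hs x)
      (by simpa only [Complex.ofReal_mul] using hv x hx)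
  · rw [add_sub_cancel_left, norm_smul, mul_comm]
    gcongr
    exact hvC x hx

end ConvergentRiccatiSolution

theorem openWedge_subset_openWedge {M M' b b' : ℝ} (hM : M ≤ M') (hb : b' ≤ b) (hb0 : 0 ≤ b) :
    openWedge M' b' ⊆ openWedge M b := by
  rintro x ⟨hre, him⟩
  refine ⟨hM.trans_lt hre, him.trans_le ?_⟩
  calc b' * (x.re - M') ≤ b * (x.re - M') := mul_le_mul_of_nonneg_right hb (by linarith)
    _ ≤ b * (x.re - M) := by gcongr

theorem exists_bounded_rightInverse {E : Type*} [NormedAddCommGroup E] [NormedSpace ℂ E]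
    [FiniteDimensional ℂ E] {Λ : E →ₗ[ℂ] E} (hΛ : Function.Injective Λ) :
    ∃ (S : E →ₗ[ℂ] E) (C : ℝ), (∀ c, Λ (S c) = c) ∧ ∀ c, ‖S c‖ ≤ C * ‖c‖ :=
  let e := LinearEquiv.ofInjectiveEndo Λ hΛ
  ⟨e.symm, ‖LinearMap.toContinuousLinearMap (e.symm : E →ₗ[ℂ] E)‖, e.apply_symm_apply,
    (LinearMap.toContinuousLinearMap (e.symm : E →ₗ[ℂ] E)).le_opNorm⟩

theorem exists_riccati_solution_near_diagonal {ι κ : Type*} [Fintype ι] [Fintype κ]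
    {A : Matrix ι ι ℂ} {B : Matrix κ κ ℂ} {U : Set ℂ} {h C η ε σ γ R : ℝ}
    {S : Matrix κ ι ℂ →ₗ[ℂ] Matrix κ ι ℂ}
    {K : BddHol U (Matrix κ ι ℂ) →L[ℂ] BddHol U (Matrix κ ι ℂ)}
    (hU : IsOpen U) (hre : ∀ x ∈ U, 0 ≤ x.re) (hh : 0 < h) (hη : 0 ≤ η)
    (hK : IsSolutionOperator h (sylvester A B) K) (hKC : ‖K‖ ≤ C)
    (hS : ∀ c, sylvester A B (S c) = c) (hSC : ∀ c, ‖S c‖ ≤ C * ‖c‖)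
    {Z : ℂ → Matrix (ι ⊕ κ) (ι ⊕ κ) ℂ} {Zinf : Matrix (ι ⊕ κ) (ι ⊕ κ) ℂ}
    (hZ : DifferentiableOn ℂ Z U) (hZε : ∀ x ∈ U, ‖Z x - Matrix.fromBlocks A 0 0 B‖ ≤ ε)
    (hZinfε : ‖Zinf - Matrix.fromBlocks A 0 0 B‖ ≤ ε)
    (hZσ : ∀ x ∈ U, ‖Z x - Zinf‖ ≤ σ * Real.exp (-η * x.re))
    (hγ : ∀ x ∈ U, ‖(Z x - Zinf).toBlocks₂₁‖ ≤ γ * Real.exp (-η * x.re))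
    (hinfγ : ‖Zinf.toBlocks₂₁‖ ≤ γ) (hCε : C * (6 * ε + h * η) ≤ 1 / 2) (hσ0 : 0 ≤ σ)
    (hR : 2 * (C * (γ * (1 + 6 * C * σ))) = R) (hR1 : R ≤ 1) :
    ∃ (y : ℂ → Matrix κ ι ℂ) (a : Matrix κ ι ℂ),
      (∀ x ∈ U, HasDerivAt y ((h : ℂ)⁻¹ • riccati (Z x) (y x)) x) ∧
      (Zinf.toBlocks₂₁ = 0 → a = 0) ∧ (∀ x ∈ U, ‖y x‖ ≤ 2 * R) ∧
      ∀ x ∈ U, ‖y x - a‖ ≤ R * Real.exp (-η * x.re) := by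
  have hinf₂₁ : (Zinf - Matrix.fromBlocks A 0 0 B).toBlocks₂₁ = Zinf.toBlocks₂₁ := sub_zero _
  obtain ⟨y, a, hy, ha, hya⟩ := exists_convergent_riccati_solution
    (Z := fun x => Z x - Matrix.fromBlocks A 0 0 B) (Zinf := Zinf - Matrix.fromBlocks A 0 0 B)
    hU hre hh hη hK hKC hS hSC (hZ.sub_const _) hZε hZinfε
    (by simpa only [sub_sub_sub_cancel_right] using hZσ)
    (by simpa only [sub_sub_sub_cancel_right] using hγ) (hinf₂₁.symm ▸ hinfγ) hCε hσ0
    (hR.trans_le hR1)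
  rw [hinf₂₁] at ha
  rw [hR] at hya
  have hC0 : 0 ≤ C := (norm_nonneg K).trans hKC
  have haR : ‖a‖ ≤ R := by
    refine ha.trans (hR.subst (motive := fun R => _ ≤ R) ?_)
    gcongr
    exact hinfγ.trans (le_mul_of_one_le_right ((norm_nonneg _).trans hinfγ)
      (le_add_of_nonneg_right (by positivity)))
  refine ⟨y, a, fun x hx => (hy x hx).congr_deriv ?_, fun h0 => ?_, fun x hx => ?_, hya⟩
  · rw [← riccati_fromBlocks_diagonal, ← riccati_add_left, add_sub_cancel]
  · simpa [h0] using ha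
  · have hexp : Real.exp (-η * x.re) ≤ 1 := Real.exp_le_one_iff.2
      (mul_nonpos_of_nonpos_of_nonneg (neg_nonpos.2 hη) (hre x hx))
    linarith [norm_le_norm_sub_add (y x) a, hya x hx,
      mul_le_of_le_one_right ((norm_nonneg a).trans haR) hexp]

section WeaklyCoupled

variable {ι κ : Type*} [Fintype ι] [Fintype κ] {Z : ℝ → ℂ → Matrix (ι ⊕ κ) (ι ⊕ κ) ℂ}
  {Zinf : ℝ → Matrix (ι ⊕ κ) (ι ⊕ κ) ℂ} {A : Matrix ι ι ℂ} {B : Matrix κ κ ℂ} {M β : ℝ}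
  {ω : ℝ → ℝ} {α η C : ℝ}

/-- As `h → 0⁺`, the coefficients `Z h` are holomorphic on `openWedge M β` and, uniformly in `h`,
exponentially close to `Zinf h`, where `Zinf h → diag(A, B)`. The off-diagonal blocks are of size
`ω h → 0`. The part of `Z h - Zinf h` that does not vanish as `h → 0⁺` decays at a rate `α > 0`,
the part of size `ω h` at the possibly smaller rate `η`; `η = 0` encodes mere boundedness. -/
structure WeaklyCoupled (Z : ℝ → ℂ → Matrix (ι ⊕ κ) (ι ⊕ κ) ℂ)
    (Zinf : ℝ → Matrix (ι ⊕ κ) (ι ⊕ κ) ℂ) (A : Matrix ι ι ℂ) (B : Matrix κ κ ℂ) (M β : ℝ)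
    (ω : ℝ → ℝ) (α η C : ℝ) : Prop where
  tendsto_coupling : Tendsto ω (𝓝[>] 0) (𝓝 0)
  coupling_nonneg : ∀ᶠ h in 𝓝[>] 0, 0 ≤ ω h
  tendsto_limit : Tendsto Zinf (𝓝[>] 0) (𝓝 (Matrix.fromBlocks A 0 0 B))
  rate_pos : 0 < α
  rate_nonneg : 0 ≤ η
  rate_le : η ≤ α
  const_nonneg : 0 ≤ C
  differentiableOn : ∀ᶠ h in 𝓝[>] 0, DifferentiableOn ℂ (Z h) (openWedge M β)
  norm_sub_le : ∀ᶠ h in 𝓝[>] 0, ∀ x ∈ openWedge M β,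
    ‖Z h x - Zinf h‖ ≤ C * (Real.exp (-α * x.re) + ω h * Real.exp (-η * x.re))
  norm_toBlocks₂₁_sub_le : ∀ᶠ h in 𝓝[>] 0, ∀ x ∈ openWedge M β,
    ‖(Z h x - Zinf h).toBlocks₂₁‖ ≤ C * ω h * Real.exp (-η * x.re)
  norm_toBlocks₁₂_sub_le : ∀ᶠ h in 𝓝[>] 0, ∀ x ∈ openWedge M β,
    ‖(Z h x - Zinf h).toBlocks₁₂‖ ≤ C * ω h * Real.exp (-η * x.re)
  norm_toBlocks₂₁_le : ∀ᶠ h in 𝓝[>] 0, ‖(Zinf h).toBlocks₂₁‖ ≤ C * ω h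
  norm_toBlocks₁₂_le : ∀ᶠ h in 𝓝[>] 0, ‖(Zinf h).toBlocks₁₂‖ ≤ C * ω h

namespace WeaklyCoupled

variable (hZ : WeaklyCoupled Z Zinf A B M β ω α η C)

include hZ

theorem swap : WeaklyCoupled (fun h x => (Z h x).submatrix Sum.swap Sum.swap)
    (fun h => (Zinf h).submatrix Sum.swap Sum.swap) B A M β ω α η C where
  __ := hZ
  tendsto_limit := by
    have hcont : Continuous fun P : Matrix (ι ⊕ κ) (ι ⊕ κ) ℂ => P.submatrix Sum.swap Sum.swap :=
      continuous_id.matrix_submatrix _ _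
    simpa only [Matrix.fromBlocks_submatrix_sum_swap_sum_swap] using!
      (hcont.tendsto (Matrix.fromBlocks A 0 0 B)).comp hZ.tendsto_limit
  differentiableOn := hZ.differentiableOn.mono fun h hh =>
    differentiableOn_submatrix Sum.swap Sum.swap hh
  norm_sub_le := hZ.norm_sub_le.mono fun h hh x hx =>
    (norm_submatrix_le (Z h x - Zinf h) Sum.swap Sum.swap_leftInverse.injective).trans (hh x hx)
  norm_toBlocks₂₁_sub_le := hZ.norm_toBlocks₁₂_sub_le
  norm_toBlocks₁₂_sub_le := hZ.norm_toBlocks₂₁_sub_le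
  norm_toBlocks₂₁_le := hZ.norm_toBlocks₁₂_le
  norm_toBlocks₁₂_le := hZ.norm_toBlocks₂₁_le

theorem eventually_norm_sub_le_exp : ∀ᶠ h in 𝓝[>] 0, ∀ x ∈ openWedge M β, 0 ≤ x.re →
    ‖Z h x - Zinf h‖ ≤ 2 * C * Real.exp (-η * x.re) := by
  filter_upwards [hZ.norm_sub_le, hZ.tendsto_coupling.eventually_le_const one_pos]
    with h hsub hω x hx hre
  have hC := hZ.const_nonneg
  calc ‖Z h x - Zinf h‖ ≤ C * (Real.exp (-α * x.re) + ω h * Real.exp (-η * x.re)) := hsub x hx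
    _ ≤ C * (Real.exp (-η * x.re) + 1 * Real.exp (-η * x.re)) := by
        gcongr
        exact hZ.rate_le
    _ = 2 * C * Real.exp (-η * x.re) := by ring

theorem eventually_norm_sub_diagonal_le {ε : ℝ} (hε : 0 < ε) :
    ∀ᶠ M₁ in atTop, ∀ᶠ h in 𝓝[>] 0, ∀ x ∈ openWedge M β, M₁ ≤ x.re →
      ‖Z h x - Matrix.fromBlocks A 0 0 B‖ ≤ ε := by
  have hexp : Tendsto (fun M₁ : ℝ => C * Real.exp (-α * M₁)) atTop (𝓝 0) := by
    simpa using (Real.tendsto_exp_atBot.comp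
      (tendsto_id.const_mul_atTop_of_neg (neg_neg_of_pos hZ.rate_pos))).const_mul C
  have hcoupling : Tendsto (fun h => C * ω h) (𝓝[>] 0) (𝓝 0) := by
    simpa using hZ.tendsto_coupling.const_mul C
  have hlimit := tendsto_iff_norm_sub_tendsto_zero.1 hZ.tendsto_limit
  filter_upwards [hexp.eventually_le_const (by positivity : 0 < ε / 3), eventually_ge_atTop 0]
    with M₁ hM₁ hM₁0
  filter_upwards [hZ.norm_sub_le, hZ.norm_toBlocks₂₁_le,
    hcoupling.eventually_le_const (by positivity : 0 < ε / 3),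
    hlimit.eventually_le_const (by positivity : 0 < ε / 3)] with h hsub hω hωε hlim x hx hre
  have hα : C * Real.exp (-α * x.re) ≤ ε / 3 := le_trans
    (mul_le_mul_of_nonneg_left (Real.exp_le_exp.2
      (mul_le_mul_of_nonpos_left hre (neg_nonpos.2 hZ.rate_pos.le))) hZ.const_nonneg) hM₁
  have hη : C * ω h * Real.exp (-η * x.re) ≤ ε / 3 := le_trans
    (mul_le_of_le_one_right ((norm_nonneg _).trans hω) (Real.exp_le_one_iff.2
      (mul_nonpos_of_nonpos_of_nonneg (neg_nonpos.2 hZ.rate_nonneg) (hM₁0.trans hre)))) hωε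
  calc ‖Z h x - Matrix.fromBlocks A 0 0 B‖
      ≤ ‖Z h x - Zinf h‖ + ‖Zinf h - Matrix.fromBlocks A 0 0 B‖ :=
        norm_sub_le_norm_sub_add_norm_sub _ _ _
    _ ≤ C * (Real.exp (-α * x.re) + ω h * Real.exp (-η * x.re)) + ε / 3 :=
        add_le_add (hsub x hx) hlim
    _ ≤ ε := by linarith

theorem exists_riccati_solution_of_isSolutionOperator (hβ : 0 ≤ β) {b : ℝ}
    (hb : b ≤ β) {K : BddHol (openWedge 0 b) (Matrix κ ι ℂ) →L[ℂ] BddHol (openWedge 0 b) _}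
    {S : Matrix κ ι ℂ →ₗ[ℂ] Matrix κ ι ℂ} (hK : IsSolutionOperator 1 (sylvester A B) K)
    (hS : ∀ c, sylvester A B (S c) = c) {C₁ : ℝ} (hC₁ : 0 < C₁) (hKC : ‖K‖ ≤ C₁)
    (hSC : ∀ c, ‖S c‖ ≤ C₁ * ‖c‖) :
    ∃ R, ∀ᶠ M₁ in atTop, ∀ᶠ h : ℝ in 𝓝[>] 0,
      ∃ (y : ℂ → Matrix κ ι ℂ) (a : Matrix κ ι ℂ),
        (∀ x ∈ openWedge M₁ b, HasDerivAt y ((h : ℂ)⁻¹ • riccati (Z h x) (y x)) x) ∧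
        ((Zinf h).toBlocks₂₁ = 0 → a = 0) ∧
        (∀ x ∈ openWedge M₁ b, ‖y x‖ ≤ R * ω h) ∧
        ∀ x ∈ openWedge M₁ b, ‖y x - a‖ ≤ R * ω h * Real.exp (-η * x.re) := by
  obtain ⟨ε, hε, hC₁ε⟩ : ∃ ε, 0 < ε ∧ C₁ * (6 * ε) = 1 / 4 := ⟨1 / (24 * C₁), by positivity, by
    field_simp; norm_num⟩
  set R := 2 * (C₁ * (C * (1 + 6 * C₁ * (2 * C)))) with hR
  have hRω : Tendsto (fun h => R * ω h) (𝓝[>] 0) (𝓝 0) := by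
    simpa using hZ.tendsto_coupling.const_mul R
  have hhη : Tendsto (fun h => C₁ * (h * η)) (𝓝[>] 0) (𝓝 0) :=
    tendsto_nhdsWithin_of_tendsto_nhds <| Continuous.tendsto' (by fun_prop) _ _ (by simp)
  have hlimit := tendsto_iff_norm_sub_tendsto_zero.1 hZ.tendsto_limit
  have hC := hZ.const_nonneg
  refine ⟨2 * R, ?_⟩
  filter_upwards [hZ.eventually_norm_sub_diagonal_le hε, eventually_ge_atTop 0,
    eventually_ge_atTop M] with M₁ hsmall hM₁0 hM₁
  have hsub : openWedge M₁ b ⊆ openWedge M β := openWedge_subset_openWedge hM₁ hb hβ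
  have hre : ∀ x ∈ openWedge M₁ b, M₁ ≤ x.re := fun x hx => hx.1.le
  filter_upwards [self_mem_nhdsWithin, hsmall, hZ.differentiableOn,
    hlimit.eventually_le_const hε, hRω.eventually_le_const one_pos,
    hhη.eventually_le_const (by norm_num : (0 : ℝ) < 1 / 4), hZ.eventually_norm_sub_le_exp,
    hZ.norm_toBlocks₂₁_sub_le, hZ.norm_toBlocks₂₁_le, hZ.coupling_nonneg]
    with h hh hsmall hdiff hlim hRω hhη hexp h₂₁sub h₂₁ hω
  obtain ⟨K', hK', hK'C⟩ := hK.rescale M₁ hh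
  obtain ⟨y, a, hy, ha0, hyR, hya⟩ := exists_riccati_solution_near_diagonal
    (σ := 2 * C) (γ := C * ω h) (R := R * ω h) (isOpen_openWedge M₁ b)
    (fun x hx => hM₁0.trans (hre x hx)) hh hZ.rate_nonneg hK' (hK'C.trans hKC) hS hSC
    (hdiff.mono hsub) (fun x hx => hsmall x (hsub hx) (hre x hx)) hlim
    (fun x hx => hexp x (hsub hx) (hM₁0.trans (hre x hx))) (fun x hx => h₂₁sub x (hsub hx))
    h₂₁ (by linarith) (by positivity) (by rw [hR]; ring) hRω
  refine ⟨y, a, hy, ha0, fun x hx => (hyR x hx).trans_eq (mul_assoc _ _ _).symm,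
    fun x hx => (hya x hx).trans ?_⟩
  have hRω0 : 0 ≤ R * ω h := by positivity
  exact mul_le_mul_of_nonneg_right (by linarith) (Real.exp_nonneg _)

theorem eventually_exists_riccati_solution [DecidableEq ι] [DecidableEq κ] (hβ : 0 < β)
    (hAB : Disjoint (spectrum ℂ A) (spectrum ℂ B)) :
    ∀ᶠ b in 𝓝[>] (0 : ℝ), ∃ R, ∀ᶠ M₁ in atTop, ∀ᶠ h : ℝ in 𝓝[>] 0,
      ∃ (y : ℂ → Matrix κ ι ℂ) (a : Matrix κ ι ℂ),
        (∀ x ∈ openWedge M₁ b, HasDerivAt y ((h : ℂ)⁻¹ • riccati (Z h x) (y x)) x) ∧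
        ((Zinf h).toBlocks₂₁ = 0 → a = 0) ∧
        (∀ x ∈ openWedge M₁ b, ‖y x‖ ≤ R * ω h) ∧
        ∀ x ∈ openWedge M₁ b, ‖y x - a‖ ≤ R * ω h * Real.exp (-η * x.re) := by
  have hinj := sylvester_injective hAB
  obtain ⟨S, C_S, hS, hSC⟩ := exists_bounded_rightInverse hinj
  filter_upwards [eventually_exists_isSolutionOperator hinj, Ioc_mem_nhdsGT hβ] with b ⟨K, hK⟩ hb
  obtain ⟨C₁, hKC, hSC₁, hC₁⟩ : ∃ C₁, ‖K‖ ≤ C₁ ∧ C_S ≤ C₁ ∧ 0 < C₁ :=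
    ⟨max (max ‖K‖ C_S) 1, by simp, by simp, by simp⟩
  exact hZ.exists_riccati_solution_of_isSolutionOperator hβ.le hb.2 hK hS hC₁ hKC
    fun c => (hSC c).trans (by gcongr)

end WeaklyCoupled

end WeaklyCoupled

section Conjugator

variable {m n : ℕ}

theorem isBlockDiagConjugator_of_riccati {h : ℝ} (hh : h ≠ 0) {U : Set ℂ} (hU : IsOpen U)
    {Z : ℂ → Matrix (Fin m ⊕ Fin n) (Fin m ⊕ Fin n) ℂ} (hZ : DifferentiableOn ℂ Z U)
    {X : ℂ → Matrix (Fin m) (Fin n) ℂ} {Y : ℂ → Matrix (Fin n) (Fin m) ℂ}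
    (hX : ∀ x ∈ U,
      HasDerivAt X ((h : ℂ)⁻¹ • riccati ((Z x).submatrix Sum.swap Sum.swap) (X x)) x)
    (hY : ∀ x ∈ U, HasDerivAt Y ((h : ℂ)⁻¹ • riccati (Z x) (Y x)) x)
    (hunit : ∀ x ∈ U, IsUnit (Matrix.fromBlocks 1 (X x) (Y x) 1)) :
    IsBlockDiagConjugator h U Z (fun x => Matrix.fromBlocks 1 (X x) (Y x) 1) := by
  have hdX : DifferentiableOn ℂ X U := fun x hx => (hX x hx).differentiableAt.differentiableWithinAt
  have hdY : DifferentiableOn ℂ Y U := fun x hx => (hY x hx).differentiableAt.differentiableWithinAt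
  have h₁₁ := differentiableOn_submatrix Sum.inl Sum.inl hZ
  have h₁₂ := differentiableOn_submatrix Sum.inl Sum.inr hZ
  have h₂₁ := differentiableOn_submatrix Sum.inr Sum.inl hZ
  have h₂₂ := differentiableOn_submatrix Sum.inr Sum.inr hZ
  refine ⟨(differentiableOn_fromBlocks (differentiableOn_const _) hdX hdY
      (differentiableOn_const _)).analyticOnNhd hU, hunit,
    fun x => (Z x).toBlocks₁₁ + (Z x).toBlocks₁₂ * Y x,
    fun x => (Z x).toBlocks₂₂ + (Z x).toBlocks₂₁ * X x,
    (h₁₁.add (differentiableOn_matrix_mul h₁₂ hdY)).analyticOnNhd hU,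
    (h₂₂.add (differentiableOn_matrix_mul h₂₁ hdX)).analyticOnNhd hU, fun x hx => ?_⟩
  have hderiv := hasDerivAt_fromBlocks (hasDerivAt_const x 1) (hX x hx) (hY x hx)
    (hasDerivAt_const x 1)
  have hX' : riccati ((Z x).submatrix Sum.swap Sum.swap) (X x) = (Z x).toBlocks₁₂
      + (Z x).toBlocks₁₁ * X x - X x * (Z x).toBlocks₂₂ - X x * (Z x).toBlocks₂₁ * X x := rfl
  have hh0 : (h : ℂ) ≠ 0 := mod_cast hh
  refine (congrArg (fun D => (h : ℂ) • D + _) hderiv.deriv).trans ?_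
  conv_rhs => rw [← Matrix.fromBlocks_toBlocks (Z x)]
  rw [hX', riccati, Matrix.fromBlocks_smul, smul_inv_smul₀ hh0, smul_inv_smul₀ hh0,
    Matrix.fromBlocks_multiply, Matrix.fromBlocks_multiply, Matrix.fromBlocks_add]
  simp only [smul_zero, Matrix.one_mul, Matrix.mul_one, Matrix.mul_zero, Matrix.mul_add,
    Matrix.mul_assoc, zero_add, add_zero]
  congr 1 <;> abel

theorem norm_fromBlocks_one_one_sub_le {ι κ : Type*} [Fintype ι] [Fintype κ] [DecidableEq ι]
    [DecidableEq κ] (X X' : Matrix ι κ ℂ) (Y Y' : Matrix κ ι ℂ) :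
    ‖Matrix.fromBlocks 1 X Y 1 - Matrix.fromBlocks 1 X' Y' 1‖ ≤ max ‖X - X'‖ ‖Y - Y'‖ := by
  rw [sub_eq_add_neg, Matrix.fromBlocks_neg, Matrix.fromBlocks_add]
  simpa [sub_eq_add_neg] using norm_fromBlocks_le 0 (X - X') (Y - Y') 0

theorem WeaklyCoupled.eventually_exists_conjugator
    {Z : ℝ → ℂ → Matrix (Fin m ⊕ Fin n) (Fin m ⊕ Fin n) ℂ}
    {Zinf : ℝ → Matrix (Fin m ⊕ Fin n) (Fin m ⊕ Fin n) ℂ} {A : Matrix (Fin m) (Fin m) ℂ}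
    {B : Matrix (Fin n) (Fin n) ℂ} {M β : ℝ} {ω : ℝ → ℝ} {α η C : ℝ}
    (hZ : WeaklyCoupled Z Zinf A B M β ω α η C) (hβ : 0 < β)
    (hAB : Disjoint (spectrum ℂ A) (spectrum ℂ B)) :
    ∀ᶠ b in 𝓝[>] (0 : ℝ), ∃ R, ∀ᶠ M₁ in atTop, ∀ᶠ h : ℝ in 𝓝[>] 0,
      ∃ (T : ℂ → Matrix (Fin m ⊕ Fin n) (Fin m ⊕ Fin n) ℂ)
        (Tinf : Matrix (Fin m ⊕ Fin n) (Fin m ⊕ Fin n) ℂ),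
        IsBlockDiagConjugator h (openWedge M₁ b) (Z h) T ∧
        (∀ x ∈ openWedge M₁ b, ‖T x - 1‖ ≤ R * ω h) ∧
        (∀ x ∈ openWedge M₁ b, ‖T x - Tinf‖ ≤ R * ω h * Real.exp (-η * x.re)) ∧
        ((Zinf h).toBlocks₁₂ = 0 → (Zinf h).toBlocks₂₁ = 0 → Tinf = 1) := by
  filter_upwards [hZ.eventually_exists_riccati_solution hβ hAB,
    hZ.swap.eventually_exists_riccati_solution hβ hAB.symm, Ioc_mem_nhdsGT hβ]
    with b ⟨R₂, hR₂⟩ ⟨R₁, hR₁⟩ hb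
  set R := max R₁ R₂
  have hRω : Tendsto (fun h => R * ω h) (𝓝[>] 0) (𝓝 0) := by
    simpa using hZ.tendsto_coupling.const_mul R
  refine ⟨R, ?_⟩
  filter_upwards [hR₂, hR₁, eventually_ge_atTop M] with M₁ hY hX hM₁
  filter_upwards [hY, hX, self_mem_nhdsWithin, hZ.coupling_nonneg, hZ.differentiableOn,
    hRω.eventually_lt_const one_pos]
    with h ⟨Y, c, hY, hc, hYR, hYc⟩ ⟨X, a, hX, ha, hXR, hXa⟩ hh hω hdiff hlt
  have hR₁ω : R₁ * ω h ≤ R * ω h := mul_le_mul_of_nonneg_right (le_max_left _ _) hω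
  have hR₂ω : R₂ * ω h ≤ R * ω h := mul_le_mul_of_nonneg_right (le_max_right _ _) hω
  have hT1 : ∀ x ∈ openWedge M₁ b, ‖Matrix.fromBlocks 1 (X x) (Y x) 1 - 1‖ ≤ R * ω h :=
    fun x hx => by
      rw [← Matrix.fromBlocks_one]
      refine (norm_fromBlocks_one_one_sub_le _ _ _ _).trans (max_le ?_ ?_)
      · simpa only [sub_zero] using (hXR x hx).trans hR₁ω
      · simpa only [sub_zero] using (hYR x hx).trans hR₂ω
  refine ⟨fun x => Matrix.fromBlocks 1 (X x) (Y x) 1, Matrix.fromBlocks 1 a c 1,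
    isBlockDiagConjugator_of_riccati hh.ne' (isOpen_openWedge M₁ b)
      (hdiff.mono (openWedge_subset_openWedge hM₁ hb.2 hβ.le)) hX hY
      fun x hx => isUnit_of_norm_sub_one_lt ((hT1 x hx).trans_lt hlt),
    hT1, fun x hx => (norm_fromBlocks_one_one_sub_le _ _ _ _).trans (max_le ?_ ?_),
    fun h₁₂ h₂₁ => by rw [ha h₁₂, hc h₂₁, Matrix.fromBlocks_one]⟩
  · exact (hXa x hx).trans (by gcongr)
  · exact (hYc x hx).trans (by gcongr)

end Conjugator

section Assembly

theorem wedge_subset_openWedge {M β : ℝ} (hβ : 0 < β) : wedge (M + 1) (β / 2) ⊆ openWedge M β := by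
  rintro x ⟨hre, him⟩
  refine ⟨by linarith, him.trans_lt ?_⟩
  nlinarith

theorem openWedge_subset_wedge (M β : ℝ) : openWedge M β ⊆ wedge M β :=
  fun _ hx => ⟨hx.1.le, hx.2.le⟩

theorem IsBlockDiagConjugator.mono {m n : ℕ} {h : ℝ} {S S' : Set ℂ}
    {G T : ℂ → Matrix (Fin m ⊕ Fin n) (Fin m ⊕ Fin n) ℂ} (hT : IsBlockDiagConjugator h S G T)
    (hS : S' ⊆ S) : IsBlockDiagConjugator h S' G T := by
  obtain ⟨hol, hunit, D₁, D₂, hD₁, hD₂, heq⟩ := hT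
  exact ⟨hol.mono hS, fun x hx => hunit x (hS hx), D₁, D₂, hD₁.mono hS, hD₂.mono hS,
    fun x hx => heq x (hS hx)⟩

/-- `F h x → L h` as `Re x → ∞` in `S` at the given exponential rate `η`, uniformly for
`0 < h ≤ h₀`. For `η = 0` this only says that `F - L` is bounded. -/
def UniformExpConvAt {E : Type*} [NormedAddCommGroup E] (η h₀ : ℝ) (S : Set ℂ) (F : ℝ → ℂ → E)
    (L : ℝ → E) : Prop :=
  ∃ C, ∀ h ∈ Ioc 0 h₀, ∀ x ∈ S, ‖F h x - L h‖ ≤ C * Real.exp (-η * x.re)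

section UniformExpConvAt

variable {E : Type*} [NormedAddCommGroup E] {η h₀ M β : ℝ} {S : Set ℂ} {F : ℝ → ℂ → E} {L : ℝ → E}

theorem UniformExpConv.exists_rate (hF : UniformExpConv h₀ S F L) :
    ∃ η, 0 < η ∧ UniformExpConvAt η h₀ S F L :=
  let ⟨C, η, hη, hF⟩ := hF
  ⟨η, hη, C, hF⟩

theorem UniformBdd.uniformExpConvAt_zero (hF : UniformBdd h₀ S F) :
    UniformExpConvAt 0 h₀ S F fun _ => 0 :=
  let ⟨C, hF⟩ := hF
  ⟨C, fun h hh x hx => by simpa using hF h hh x hx⟩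

theorem UniformExpConvAt.of_le {η' : ℝ} (hF : UniformExpConvAt η h₀ (wedge M β) F L)
    (hη : η' ≤ η) : UniformExpConvAt η' h₀ (wedge M β) F L := by
  obtain ⟨C, hF⟩ := hF
  refine ⟨|C| * Real.exp (-(η - η') * M), fun h hh x hx => (hF h hh x hx).trans ?_⟩
  calc C * Real.exp (-η * x.re)
      = C * (Real.exp (-(η - η') * x.re) * Real.exp (-η' * x.re)) := by
        rw [← Real.exp_add]; ring_nf
    _ ≤ |C| * (Real.exp (-(η - η') * M) * Real.exp (-η' * x.re)) := by
        gcongr ?_ * (Real.exp ?_ * _)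
        · exact le_abs_self C
        · exact mul_le_mul_of_nonpos_left hx.1 (neg_nonpos.2 (sub_nonneg.2 hη))
    _ = |C| * Real.exp (-(η - η') * M) * Real.exp (-η' * x.re) := (mul_assoc _ _ _).symm

theorem UniformExpConvAt.eventually_const (hF : UniformExpConvAt η h₀ S F L) :
    ∀ᶠ C in atTop, ∀ h ∈ Ioc 0 h₀, ∀ x ∈ S, ‖F h x - L h‖ ≤ C * Real.exp (-η * x.re) := by
  obtain ⟨C₀, hF⟩ := hF
  filter_upwards [eventually_ge_atTop C₀] with C hC h hh x hx
  exact (hF h hh x hx).trans (by gcongr)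

theorem UniformExpConvAt.eventually_norm_limit_le (hF : UniformExpConvAt η h₀ (wedge M β) F L)
    (hbdd : UniformBdd h₀ (wedge M β) F) : ∀ᶠ C in atTop, ∀ h ∈ Ioc 0 h₀, ‖L h‖ ≤ C := by
  obtain ⟨C₀, hF⟩ := hF
  obtain ⟨B, hB⟩ := hbdd
  have hM : (M : ℂ) ∈ wedge M β := by simp [wedge]
  filter_upwards [eventually_ge_atTop (C₀ * Real.exp (-η * M) + B)] with C hC h hh
  calc ‖L h‖ ≤ ‖L h - F h M‖ + ‖F h M‖ := norm_le_norm_sub_add _ _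
    _ ≤ C₀ * Real.exp (-η * M) + B :=
        add_le_add ((norm_sub_rev _ _).trans_le (hF h hh M hM)) (hB h hh M hM)
    _ ≤ C := hC

theorem UniformExpConv.congr_limit {L' : ℝ → E} (hF : UniformExpConv h₀ S F L)
    (hL : ∀ h ∈ Ioc 0 h₀, L h = L' h) : UniformExpConv h₀ S F L' :=
  let ⟨C, η, hη, hF⟩ := hF
  ⟨C, η, hη, fun h hh x hx => hL h hh ▸ hF h hh x hx⟩

theorem UniformBdd.exists_uniformExpConvAt {α : ℝ} (hα : 0 < α)
    (hbdd : UniformBdd h₀ (wedge M β) F) :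
    ∃ L η, 0 ≤ η ∧ η ≤ α ∧ UniformExpConvAt η h₀ (wedge M β) F L ∧
      ((∃ L, UniformExpConv h₀ (wedge M β) F L) → 0 < η) ∧
      (UniformExpConv h₀ (wedge M β) F (fun _ => 0) → L = 0) := by
  have of_conv : ∀ L, UniformExpConv h₀ (wedge M β) F L →
      ∃ η, 0 < η ∧ η ≤ α ∧ UniformExpConvAt η h₀ (wedge M β) F L := fun L hL =>
    let ⟨η, hη, hL⟩ := hL.exists_rate
    ⟨min η α, lt_min hη hα, min_le_right _ _, hL.of_le (min_le_left _ _)⟩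
  by_cases h0 : UniformExpConv h₀ (wedge M β) F fun _ => 0
  · obtain ⟨η, hη, hηα, hF⟩ := of_conv _ h0
    exact ⟨_, η, hη.le, hηα, hF, fun _ => hη, fun _ => rfl⟩
  by_cases hL : ∃ L, UniformExpConv h₀ (wedge M β) F L
  · obtain ⟨L, hL⟩ := hL
    obtain ⟨η, hη, hηα, hF⟩ := of_conv L hL
    exact ⟨L, η, hη.le, hηα, hF, fun _ => hη, fun h => absurd h h0⟩
  · exact ⟨_, 0, le_rfl, hα.le, hbdd.uniformExpConvAt_zero, fun h => absurd h hL,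
      fun h => absurd h h0⟩

end UniformExpConvAt

variable {m n p : ℕ} {M β h₀ α η : ℝ} {A₁₁ : ℝ → ℂ → Matrix (Fin m) (Fin m) ℂ}
  {A₂₂ : ℝ → ℂ → Matrix (Fin n) (Fin n) ℂ}
  {Θ : ℝ → ℂ → Matrix (Fin m ⊕ Fin n) (Fin m ⊕ Fin n) ℂ}
  {L₁₁ : ℝ → Matrix (Fin m) (Fin m) ℂ} {L₂₂ : ℝ → Matrix (Fin n) (Fin n) ℂ}
  {Θinf : ℝ → Matrix (Fin m ⊕ Fin n) (Fin m ⊕ Fin n) ℂ}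

/-- The limit at `+∞` of `coeff p A₁₁ A₂₂ Θ h`. -/
def coeffLimit (p : ℕ) (L₁₁ : ℝ → Matrix (Fin m) (Fin m) ℂ) (L₂₂ : ℝ → Matrix (Fin n) (Fin n) ℂ)
    (Θinf : ℝ → Matrix (Fin m ⊕ Fin n) (Fin m ⊕ Fin n) ℂ) (h : ℝ) :
    Matrix (Fin m ⊕ Fin n) (Fin m ⊕ Fin n) ℂ :=
  Matrix.fromBlocks (L₁₁ h) 0 0 (L₂₂ h) + (h : ℂ) ^ p • Θinf h

theorem coeffLimit_zero (h : ℝ) :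
    coeffLimit p L₁₁ L₂₂ 0 h = Matrix.fromBlocks (L₁₁ h) 0 0 (L₂₂ h) := by
  rw [coeffLimit, Pi.zero_apply, smul_zero, add_zero]

theorem coeff_sub_coeffLimit (h : ℝ) (x : ℂ) :
    coeff p A₁₁ A₂₂ Θ h x - coeffLimit p L₁₁ L₂₂ Θinf h =
      Matrix.fromBlocks (A₁₁ h x - L₁₁ h) 0 0 (A₂₂ h x - L₂₂ h) +
        (h : ℂ) ^ p • (Θ h x - Θinf h) := by
  rw [coeffLimit, coeff, smul_sub, add_sub_add_comm]
  congr 1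
  ext (i | i) (j | j) <;> simp

theorem norm_toBlocks₂₁_diagonal_add_smul_le (P : Matrix (Fin m) (Fin m) ℂ)
    (Q : Matrix (Fin n) (Fin n) ℂ) (c : ℂ) (N : Matrix (Fin m ⊕ Fin n) (Fin m ⊕ Fin n) ℂ) :
    ‖(Matrix.fromBlocks P 0 0 Q + c • N).toBlocks₂₁‖ ≤ ‖c‖ * ‖N‖ := by
  have heq : (Matrix.fromBlocks P 0 0 Q + c • N).toBlocks₂₁ = c • N.toBlocks₂₁ := zero_add _
  rw [heq, norm_smul]
  gcongr
  exact norm_toBlocks₂₁_le N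

theorem norm_toBlocks₁₂_diagonal_add_smul_le (P : Matrix (Fin m) (Fin m) ℂ)
    (Q : Matrix (Fin n) (Fin n) ℂ) (c : ℂ) (N : Matrix (Fin m ⊕ Fin n) (Fin m ⊕ Fin n) ℂ) :
    ‖(Matrix.fromBlocks P 0 0 Q + c • N).toBlocks₁₂‖ ≤ ‖c‖ * ‖N‖ := by
  have heq : (Matrix.fromBlocks P 0 0 Q + c • N).toBlocks₁₂ = c • N.toBlocks₁₂ := zero_add _
  rw [heq, norm_smul]
  gcongr
  exact norm_toBlocks₁₂_le N

theorem norm_diagonal_add_smul_le (P : Matrix (Fin m) (Fin m) ℂ) (Q : Matrix (Fin n) (Fin n) ℂ)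
    (c : ℂ) (N : Matrix (Fin m ⊕ Fin n) (Fin m ⊕ Fin n) ℂ) :
    ‖Matrix.fromBlocks P 0 0 Q + c • N‖ ≤ max ‖P‖ ‖Q‖ + ‖c‖ * ‖N‖ := by
  refine (norm_add_le _ _).trans (add_le_add ?_ (norm_smul c N).le)
  simpa only [norm_zero, add_zero, zero_add] using norm_fromBlocks_le P 0 0 Q

theorem differentiableOn_coeff {S : Set ℂ} {h : ℝ} (hA₁₁ : DifferentiableOn ℂ (A₁₁ h) S)
    (hA₂₂ : DifferentiableOn ℂ (A₂₂ h) S) (hΘ : DifferentiableOn ℂ (Θ h) S) :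
    DifferentiableOn ℂ (coeff p A₁₁ A₂₂ Θ h) S :=
  (differentiableOn_fromBlocks hA₁₁ (differentiableOn_const _) (differentiableOn_const _)
    hA₂₂).add (hΘ.const_smul ((h : ℂ) ^ p))

theorem tendsto_pow_nhdsGT_zero (hp : 1 ≤ p) : Tendsto (fun h : ℝ => h ^ p) (𝓝[>] 0) (𝓝 0) :=
  tendsto_nhdsWithin_of_tendsto_nhds <|
    (continuous_pow p).tendsto' _ _ (zero_pow (Nat.one_le_iff_ne_zero.1 hp))

theorem tendsto_coeffLimit (hp : 1 ≤ p) {C : ℝ} (hΘinf : ∀ᶠ h in 𝓝[>] 0, ‖Θinf h‖ ≤ C)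
    (hc₁₁ : ContinuousWithinAt L₁₁ (Ici 0) 0) (hc₂₂ : ContinuousWithinAt L₂₂ (Ici 0) 0) :
    Tendsto (coeffLimit p L₁₁ L₂₂ Θinf) (𝓝[>] 0)
      (𝓝 (Matrix.fromBlocks (L₁₁ 0) 0 0 (L₂₂ 0))) := by
  have hdiag : Tendsto (fun h => Matrix.fromBlocks (L₁₁ h) 0 0 (L₂₂ h)) (𝓝[>] 0)
      (𝓝 (Matrix.fromBlocks (L₁₁ 0) 0 0 (L₂₂ 0))) := by
    have hcont : Continuous fun P : Matrix (Fin m) (Fin m) ℂ × Matrix (Fin n) (Fin n) ℂ =>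
        Matrix.fromBlocks P.1 0 0 P.2 :=
      continuous_fst.matrix_fromBlocks continuous_const continuous_const continuous_snd
    exact (hcont.tendsto (L₁₁ 0, L₂₂ 0)).comp ((hc₁₁.mono Ioi_subset_Ici_self).prodMk_nhds
      (hc₂₂.mono Ioi_subset_Ici_self))
  have hcoupling : Tendsto (fun h : ℝ => (h : ℂ) ^ p • Θinf h) (𝓝[>] 0) (𝓝 0) := by
    refine squeeze_zero_norm' ?_
      (by simpa only [zero_mul] using (tendsto_pow_nhdsGT_zero hp).mul_const C)
    filter_upwards [self_mem_nhdsWithin, hΘinf] with h (hh : 0 < h) hΘ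
    rw [norm_smul, norm_pow, Complex.norm_of_nonneg hh.le]
    gcongr
  simpa only [add_zero] using! hdiag.add hcoupling

theorem exists_weaklyCoupled_coeff (hp : 1 ≤ p) (hh₀ : 0 < h₀) (hα : 0 < α) (hη : 0 ≤ η)
    (hηα : η ≤ α) (hA₁₁ : ∀ h ∈ Ioc 0 h₀, AnalyticOnNhd ℂ (A₁₁ h) (wedge M β))
    (hA₂₂ : ∀ h ∈ Ioc 0 h₀, AnalyticOnNhd ℂ (A₂₂ h) (wedge M β))
    (hΘ : ∀ h ∈ Ioc 0 h₀, AnalyticOnNhd ℂ (Θ h) (wedge M β))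
    (hL₁₁ : UniformExpConvAt α h₀ (wedge M β) A₁₁ L₁₁)
    (hL₂₂ : UniformExpConvAt α h₀ (wedge M β) A₂₂ L₂₂)
    (hΘbdd : UniformBdd h₀ (wedge M β) Θ) (hΘinf : UniformExpConvAt η h₀ (wedge M β) Θ Θinf)
    (hc₁₁ : ContinuousWithinAt L₁₁ (Ici 0) 0) (hc₂₂ : ContinuousWithinAt L₂₂ (Ici 0) 0) :
    ∃ C, WeaklyCoupled (coeff p A₁₁ A₂₂ Θ) (coeffLimit p L₁₁ L₂₂ Θinf) (L₁₁ 0) (L₂₂ 0) M β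
      (fun h => h ^ p) α η C := by
  obtain ⟨C, hC, hC₁₁, hC₂₂, hCΘ, hCinf⟩ := ((eventually_ge_atTop 0).and <|
    hL₁₁.eventually_const.and <| hL₂₂.eventually_const.and <| hΘinf.eventually_const.and <|
      hΘinf.eventually_norm_limit_le hΘbdd).exists
  have hsub := openWedge_subset_wedge M β
  have hev : ∀ᶠ h in 𝓝[>] 0, h ∈ Ioc 0 h₀ := Ioc_mem_nhdsGT hh₀
  have hpow : ∀ h ∈ Ioc 0 h₀, ‖(h : ℂ) ^ p‖ = h ^ p := fun h hh => by
    rw [norm_pow, Complex.norm_of_nonneg hh.1.le]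
  have hcoupling : ∀ h ∈ Ioc 0 h₀, ∀ x ∈ openWedge M β,
      ‖(h : ℂ) ^ p‖ * ‖Θ h x - Θinf h‖ ≤ C * h ^ p * Real.exp (-η * x.re) := fun h hh x hx => by
    rw [hpow h hh, mul_comm C, mul_assoc]
    exact mul_le_mul_of_nonneg_left (hCΘ h hh x (hsub hx)) (pow_nonneg hh.1.le p)
  have hlimit : ∀ h ∈ Ioc 0 h₀, ‖(h : ℂ) ^ p‖ * ‖Θinf h‖ ≤ C * h ^ p := fun h hh => by
    rw [hpow h hh, mul_comm C]
    exact mul_le_mul_of_nonneg_left (hCinf h hh) (pow_nonneg hh.1.le p)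
  refine ⟨C, tendsto_pow_nhdsGT_zero hp, hev.mono fun h hh => pow_nonneg hh.1.le p,
    tendsto_coeffLimit hp (hev.mono hCinf) hc₁₁ hc₂₂, hα, hη, hηα, hC,
    hev.mono fun h hh => differentiableOn_coeff ((hA₁₁ h hh).differentiableOn.mono hsub)
      ((hA₂₂ h hh).differentiableOn.mono hsub) ((hΘ h hh).differentiableOn.mono hsub),
    hev.mono fun h hh x hx => ?_, hev.mono fun h hh x hx => ?_, hev.mono fun h hh x hx => ?_,
    hev.mono fun h hh => (norm_toBlocks₂₁_diagonal_add_smul_le _ _ _ _).trans (hlimit h hh),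
    hev.mono fun h hh => (norm_toBlocks₁₂_diagonal_add_smul_le _ _ _ _).trans (hlimit h hh)⟩
  all_goals rw [coeff_sub_coeffLimit]
  · refine (norm_diagonal_add_smul_le _ _ _ _).trans ?_
    rw [mul_add, ← mul_assoc]
    exact add_le_add (max_le (hC₁₁ h hh x (hsub hx)) (hC₂₂ h hh x (hsub hx))) (hcoupling h hh x hx)
  · exact (norm_toBlocks₂₁_diagonal_add_smul_le _ _ _ _).trans (hcoupling h hh x hx)
  · exact (norm_toBlocks₁₂_diagonal_add_smul_le _ _ _ _).trans (hcoupling h hh x hx)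

theorem WeaklyCoupled.exists_conjugator_wedge
    {Z : ℝ → ℂ → Matrix (Fin m ⊕ Fin n) (Fin m ⊕ Fin n) ℂ}
    {Zinf : ℝ → Matrix (Fin m ⊕ Fin n) (Fin m ⊕ Fin n) ℂ} {A : Matrix (Fin m) (Fin m) ℂ}
    {B : Matrix (Fin n) (Fin n) ℂ} {ω : ℝ → ℝ} {C : ℝ}
    (hZ : WeaklyCoupled Z Zinf A B M β ω α η C) (hβ : 0 < β)
    (hAB : Disjoint (spectrum ℂ A) (spectrum ℂ B)) (hh₀ : 0 < h₀) :
    ∃ M' β' h₁ R : ℝ, M ≤ M' ∧ 0 < β' ∧ β' ≤ β ∧ 0 < h₁ ∧ h₁ ≤ h₀ ∧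
      ∃ (T : ℝ → ℂ → Matrix (Fin m ⊕ Fin n) (Fin m ⊕ Fin n) ℂ)
        (Tinf : ℝ → Matrix (Fin m ⊕ Fin n) (Fin m ⊕ Fin n) ℂ), ∀ h ∈ Ioc 0 h₁,
        IsBlockDiagConjugator h (wedge M' β') (Z h) (T h) ∧
        (∀ x ∈ wedge M' β', ‖T h x - 1‖ ≤ R * ω h) ∧
        (∀ x ∈ wedge M' β', ‖T h x - Tinf h‖ ≤ R * ω h * Real.exp (-η * x.re)) ∧
        ((Zinf h).toBlocks₁₂ = 0 → (Zinf h).toBlocks₂₁ = 0 → Tinf h = 1) := by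
  obtain ⟨b, ⟨R, hR⟩, hb, hbβ⟩ :=
    ((hZ.eventually_exists_conjugator hβ hAB).and (Ioc_mem_nhdsGT hβ)).exists
  obtain ⟨M₁, hM₁, hMM₁⟩ := (hR.and (eventually_ge_atTop M)).exists
  obtain ⟨h₂, hh₂, hT⟩ := mem_nhdsGT_iff_exists_Ioc_subset.1 hM₁
  choose! T Tinf hconj hT1 hTinf hlim using hT
  have hsub : wedge (M₁ + 1) (b / 2) ⊆ openWedge M₁ b := wedge_subset_openWedge hb
  have hmem : ∀ h ∈ Ioc 0 (min h₂ h₀), h ∈ Ioc 0 h₂ := fun h hh =>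
    ⟨hh.1, hh.2.trans (min_le_left _ _)⟩
  exact ⟨M₁ + 1, b / 2, min h₂ h₀, R, by linarith, half_pos hb, by linarith, lt_min hh₂ hh₀,
    min_le_right _ _, T, Tinf, fun h hh => ⟨(hconj (hmem h hh)).mono hsub,
      fun x hx => hT1 (hmem h hh) x (hsub hx), fun x hx => hTinf (hmem h hh) x (hsub hx),
      hlim (hmem h hh)⟩⟩

theorem mul_pow_le_abs_mul_pow (R : ℝ) (p : ℕ) {h h₁ : ℝ} (hh : h ∈ Ioc 0 h₁) :
    R * h ^ p ≤ |R| * h₁ ^ p := by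
  obtain ⟨h0, h1⟩ := hh
  gcongr
  exact le_abs_self R

end Assembly

end BlockDiag

theorem theorem1p3 (m n p : ℕ) (hp : 1 ≤ p) (M β h₀ : ℝ) (hβ : 0 < β) (hh₀ : 0 < h₀)
    (A₁₁ : ℝ → ℂ → Matrix (Fin m) (Fin m) ℂ) (A₂₂ : ℝ → ℂ → Matrix (Fin n) (Fin n) ℂ)
    (Θ : ℝ → ℂ → Matrix (Fin m ⊕ Fin n) (Fin m ⊕ Fin n) ℂ)
    (L₁₁ : ℝ → Matrix (Fin m) (Fin m) ℂ) (L₂₂ : ℝ → Matrix (Fin n) (Fin n) ℂ)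
    -- analyticity in `x` on the wedge, for every `h`
    (hA₁₁ : ∀ h ∈ Ioc 0 h₀, AnalyticOnNhd ℂ (A₁₁ h) (BlockDiag.wedge M β))
    (hA₂₂ : ∀ h ∈ Ioc 0 h₀, AnalyticOnNhd ℂ (A₂₂ h) (BlockDiag.wedge M β))
    (hΘ : ∀ h ∈ Ioc 0 h₀, AnalyticOnNhd ℂ (Θ h) (BlockDiag.wedge M β))
    -- exponential convergence to the limits at `+∞`, and boundedness, uniformly in `h`
    (hL₁₁ : BlockDiag.UniformExpConv h₀ (BlockDiag.wedge M β) A₁₁ L₁₁)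
    (hL₂₂ : BlockDiag.UniformExpConv h₀ (BlockDiag.wedge M β) A₂₂ L₂₂)
    (hΘbdd : BlockDiag.UniformBdd h₀ (BlockDiag.wedge M β) Θ)
    -- the limits are continuous in `h` at `h = 0`, where they have no common eigenvalue
    (hc₁₁ : ContinuousWithinAt L₁₁ (Ici 0) 0)
    (hc₂₂ : ContinuousWithinAt L₂₂ (Ici 0) 0)
    (hsep : Disjoint (spectrum ℂ (L₁₁ 0)) (spectrum ℂ (L₂₂ 0))) :
    ∃ M' β' h₁ : ℝ, M ≤ M' ∧ 0 < β' ∧ β' ≤ β ∧ 0 < h₁ ∧ h₁ ≤ h₀ ∧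
      ∃ T : ℝ → ℂ → Matrix (Fin m ⊕ Fin n) (Fin m ⊕ Fin n) ℂ,
        (∀ h ∈ Ioc 0 h₁,
          BlockDiag.IsBlockDiagConjugator h (BlockDiag.wedge M' β') (BlockDiag.coeff p A₁₁ A₂₂ Θ h) (T h)) ∧
        BlockDiag.UniformBdd h₁ (BlockDiag.wedge M' β') T ∧
        (∃ C : ℝ, ∀ h ∈ Ioc 0 h₁, ∀ x ∈ BlockDiag.wedge M' β', ‖T h x - 1‖ ≤ C * h ^ p) ∧
        ((∃ Θinf : ℝ → Matrix (Fin m ⊕ Fin n) (Fin m ⊕ Fin n) ℂ,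
            BlockDiag.UniformExpConv h₀ (BlockDiag.wedge M β) Θ Θinf) →
          ∃ Tinf : ℝ → Matrix (Fin m ⊕ Fin n) (Fin m ⊕ Fin n) ℂ,
            BlockDiag.UniformExpConv h₁ (BlockDiag.wedge M' β') T Tinf) ∧
        (BlockDiag.UniformExpConv h₀ (BlockDiag.wedge M β) Θ (fun _ => 0) →
          BlockDiag.UniformExpConv h₁ (BlockDiag.wedge M' β') T (fun _ => 1)) := by
  obtain ⟨α₁, hα₁, hL₁₁⟩ := hL₁₁.exists_rate
  obtain ⟨α₂, hα₂, hL₂₂⟩ := hL₂₂.exists_rate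
  have hα : 0 < min α₁ α₂ := lt_min hα₁ hα₂
  obtain ⟨Θinf, η, hη, hηα, hΘinf, hη_pos, hΘinf_zero⟩ := hΘbdd.exists_uniformExpConvAt hα
  obtain ⟨_, hcoupled⟩ := BlockDiag.exists_weaklyCoupled_coeff hp hh₀ hα hη hηα hA₁₁ hA₂₂ hΘ
    (hL₁₁.of_le (min_le_left _ _)) (hL₂₂.of_le (min_le_right _ _)) hΘbdd hΘinf hc₁₁ hc₂₂
  obtain ⟨M', β', h₁, R, hM', hβ'_pos, hβ', hh₁, hh₁₀, T, Tinf, hT⟩ :=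
    hcoupled.exists_conjugator_wedge hβ hsep hh₀
  have hconv (hη : 0 < η) : BlockDiag.UniformExpConv h₁ (BlockDiag.wedge M' β') T Tinf :=
    ⟨|R| * h₁ ^ p, η, hη, fun h hh x hx => ((hT h hh).2.2.1 x hx).trans <|
      mul_le_mul_of_nonneg_right (BlockDiag.mul_pow_le_abs_mul_pow R p hh) (Real.exp_nonneg _)⟩
  have hbdd : BlockDiag.UniformBdd h₁ (BlockDiag.wedge M' β') T :=
    ⟨|R| * h₁ ^ p + ‖(1 : Matrix (Fin m ⊕ Fin n) (Fin m ⊕ Fin n) ℂ)‖, fun h hh x hx =>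
      (norm_le_norm_sub_add _ 1).trans <| add_le_add_left (((hT h hh).2.1 x hx).trans <|
        BlockDiag.mul_pow_le_abs_mul_pow R p hh) _⟩
  refine ⟨M', β', h₁, hM', hβ'_pos, hβ', hh₁, hh₁₀, T, fun h hh => (hT h hh).1, hbdd,
    ⟨R, fun h hh => (hT h hh).2.1⟩, fun hΘconv => ⟨Tinf, hconv (hη_pos hΘconv)⟩, fun hΘ0 =>
      (hconv (hη_pos ⟨_, hΘ0⟩)).congr_limit fun h hh => ?_⟩
  obtain rfl := hΘinf_zero hΘ0
  exact (hT h hh).2.2.2 (by rw [BlockDiag.coeffLimit_zero, Matrix.toBlocks_fromBlocks₁₂])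
    (by rw [BlockDiag.coeffLimit_zero, Matrix.toBlocks_fromBlocks₂₁])
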